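/- Let $n\ge 0$ be an integer. The generalized Pauli matrices are the $4^n-1$ matrices $\sigma=\sigma_{1}\otimes\cdots\otimes\sigma_{n}$ with each factor in $\{I,X,Y,Z\}$, other than $I^{\otimes n}$. For $U\in SU(2^n)$ and a real vector $\gamma=(\gamma^\sigma)_\sigma$, write $(U,\gamma)$ for the tangent vector $\frac{d}{dt}\big|_{t=0}\exp\big(-it\sum_\sigma\gamma^\sigma\sigma\big)U\in T_U SU(2^n)$; every tangent vector at $U$ is of this form for a unique $\gamma$. A Finsler metric on $SU(2^n)$ is a function $F:T\,SU(2^n)\to[0,\infty)$ that is smooth away from the zero section and whose restriction to each tangent space vanishes only at $0$, satisfies $F(ay)=aF(y)$ for $a>0$, and has positive definite Hessian of $\tfrac12F^2$ at every $y\neq0$. It is right-invariant if it is preserved by all right translations, that is, if $F(U,\gamma)=F(I,\gamma)$ for all $U,\gamma$. A right-invariant $F$ is Pauli-symmetric if $F(U,\gamma)$ depends only on the absolute values $|\gamma^\sigma|$. A geodesic of $F$ is a smooth curve $s:J\to SU(2^n)$ on an interval $J\subseteq\mathbb R$ which in every local coordinate system $x^j$, with $y^j=dx^j/dt$ along the curve,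 satisfies $$\frac{d}{dt}\left(\frac{\partial F^2}{\partial y^j}\right)=\frac{\partial F^2}{\partial x^j}\qquad\text{for all } j.$$ **Theorem.** Let $F$ be a Pauli-symmetric right-invariant Finsler metric on $SU(2^n)$, let $\sigma_1,\dots,\sigma_k$ be pairwise commuting generalized Pauli matrices (for example a set of $n$ independent stabilizer generators), and let $S$ be the group they generate. Let $H_0=\sum_\sigma h^\sigma\sigma$ with real coefficients $h^\sigma$, where the sum is over those generalized Pauli matrices $\sigma$ for which $\sigma\in S$ or $-\sigma\in S$. Then $U(t)=\exp(-iH_0t)$, $t\in\mathbb R$, is the geodesic of $F$ with $U(0)=I$ and initial tangent vector corresponding to $H_0$. That is, $U$ takes values in $SU(2^n)$, is a geodesic of $F$, and satisfies $U(0)=I$ and $U'(0)=-iH_0$; and if $s:J\to SU(2^n)$ is a geodesic of $F$ on an interval $J\ni0$ with $s(0)=I$ and $s'(0)=-iH_0$, then $s(t)=U(t)$ for all $t\in J$. -/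

import Mathlib

open scoped Matrix ContDiff Matrix.Norms.Operator

noncomputable section

namespace PauliFinsler

/-- Computational basis labels of `n` qubits. -/
abbrev Qubits (n : ℕ) : Type := Fin n → Fin 2

/-- Operators on `n` qubits: complex `2 ^ n × 2 ^ n` matrices. -/
abbrev Op (n : ℕ) : Type := Matrix (Qubits n) (Qubits n) ℂ

/-- The group `SU(2 ^ n)`, with the topology it inherits from the matrices. -/
abbrev SU (n : ℕ) : Type := Matrix.specialUnitaryGroup (Qubits n) ℂ

/-- The single-qubit matrices `I, X, Y, Z`. -/
def pauli1 : Fin 4 → Matrix (Fin 2) (Fin 2) ℂ :=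
  ![1, !![0, 1; 1, 0], !![0, -Complex.I; Complex.I, 0], !![1, 0; 0, -1]]

/-- The `n`-fold tensor product of the single-qubit matrices named by `p`. -/
def pauliString {n : ℕ} (p : Fin n → Fin 4) : Op n :=
  Matrix.of fun a b => ∏ i, pauli1 (p i) (a i) (b i)

/-- Labels of the generalized Pauli matrices: all words in `I, X, Y, Z` except `I ⊗ ⋯ ⊗ I`. -/
abbrev PauliIndex (n : ℕ) : Type := {p : Fin n → Fin 4 // p ≠ 0}

/-- The generalized Pauli matrix with label `σ`. -/
def pauli {n : ℕ} (σ : PauliIndex n) : Op n := pauliString σ.1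

/-- Vectors of `4 ^ n - 1` real coordinates, one for each generalized Pauli matrix. -/
abbrev Coord (n : ℕ) : Type := PauliIndex n → ℝ

/-- The Hamiltonian `γ · σ = ∑ σ, γ^σ σ`. -/
def hamiltonian {n : ℕ} (γ : Coord n) : Op n := ∑ σ, (γ σ : ℂ) • pauli σ

/-- The natural `U`-adapted coordinates `γ^σ = i tr(σ A U†) / 2 ^ n` of a tangent vector
`A ∈ T_U SU(2 ^ n)`, the latter being regarded as a matrix. -/
def adaptedCoord {n : ℕ} (U : SU n) (A : Op n) : Coord n := fun σ =>
  (Complex.I * Matrix.trace (pauli σ * A * (U : Op n)ᴴ) / 2 ^ n).re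

theorem pauli1_mul_trace (j k : Fin 4) :
    ∑ x, ∑ y, pauli1 j x y * pauli1 k y x = if j = k then 2 else 0 := by
  fin_cases j <;> fin_cases k <;> simp [pauli1, Fin.sum_univ_two] <;> norm_num

theorem pauli1_unitary (j : Fin 4) : pauli1 j * (pauli1 j)ᴴ = 1 := by
  ext a b
  fin_cases j <;> fin_cases a <;> fin_cases b <;> simp [pauli1, Matrix.mul_apply, Fin.sum_univ_two]

theorem pauliString_mul_trace {n : ℕ} (p q : Fin n → Fin 4) :
    Matrix.trace (pauliString p * pauliString q) = if p = q then 2 ^ n else 0 := by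
  have h : Matrix.trace (pauliString p * pauliString q)
      = ∏ i, ∑ x, ∑ y, pauli1 (p i) x y * pauli1 (q i) y x := by
    simp only [Matrix.trace, Matrix.diag, Matrix.mul_apply, pauliString, Matrix.of_apply,
      ← Finset.prod_mul_distrib]
    rw [Finset.prod_univ_sum, Fintype.piFinset_univ]
    refine Finset.sum_congr rfl fun a _ => ?_
    rw [Finset.prod_univ_sum, Fintype.piFinset_univ]
  rw [h]
  simp only [pauli1_mul_trace]
  split_ifs with hpq
  · subst hpq; simp
  · obtain ⟨i, hi⟩ := Function.ne_iff.mp hpq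
    exact Finset.prod_eq_zero (Finset.mem_univ i) (by simp [hi])

theorem pauliString_mem_unitaryGroup {n : ℕ} (p : Fin n → Fin 4) :
    pauliString p ∈ Matrix.unitaryGroup (Qubits n) ℂ := by
  rw [Matrix.mem_unitaryGroup_iff]
  ext a b
  simp only [Matrix.mul_apply, Matrix.star_apply, pauliString, Matrix.of_apply, star_prod,
    ← Finset.prod_mul_distrib]
  have h := Finset.prod_univ_sum (fun _ : Fin n => (Finset.univ : Finset (Fin 2)))
    (fun i x => pauli1 (p i) (a i) x * star (pauli1 (p i) (b i) x))
  rw [Fintype.piFinset_univ] at h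
  rw [← h]
  have h1 : ∀ i, ∑ x, pauli1 (p i) (a i) x * star (pauli1 (p i) (b i) x)
      = (1 : Matrix (Fin 2) (Fin 2) ℂ) (a i) (b i) := fun i => by
    rw [← pauli1_unitary (p i)]; simp [Matrix.mul_apply]
  simp only [h1, Matrix.one_apply]
  by_cases hab : a = b
  · subst hab; simp
  · obtain ⟨i, hi⟩ := Function.ne_iff.mp hab
    rw [if_neg hab]
    exact Finset.prod_eq_zero (Finset.mem_univ i) (by simp [hi])

/-- The tangent vector `-i H U` of `t ↦ exp(-i H t) U` at `t = 0`, where `H = γ · σ`, has adapted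
coordinates `γ`. -/
theorem adaptedCoord_hamiltonian {n : ℕ} (U : SU n) (γ : Coord n) :
    adaptedCoord U (-(Complex.I • (hamiltonian γ * (U : Op n)))) = γ := by
  have hU : (U : Op n) * (U : Op n)ᴴ = 1 :=
    Matrix.mem_unitaryGroup_iff.mp (Matrix.specialUnitaryGroup_le_unitaryGroup U.2)
  funext σ
  have h : pauli σ * -(Complex.I • (hamiltonian γ * (U : Op n))) * (U : Op n)ᴴ
      = -(Complex.I • (pauli σ * hamiltonian γ)) := by
    simp [Matrix.mul_assoc, hU]
  have h2 : Matrix.trace (pauli σ * hamiltonian γ) = (γ σ : ℂ) * 2 ^ n := by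
    simp only [hamiltonian, Finset.mul_sum, Matrix.trace_sum, Matrix.mul_smul, Matrix.trace_smul,
      pauli, pauliString_mul_trace, smul_eq_mul, mul_ite, mul_zero, Subtype.coe_inj]
    simp
  rw [adaptedCoord, h, Matrix.trace_neg, Matrix.trace_smul, h2, smul_eq_mul]
  have h3 : Complex.I * -(Complex.I * ((γ σ : ℂ) * 2 ^ n)) / 2 ^ n = (γ σ : ℂ) := by
    field_simp
    simp
  rw [h3, Complex.ofReal_re]

/-- Right translation by `V` sends `A ∈ T_U` to `A V ∈ T_{U V}` and preserves adapted coordinates. -/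
theorem adaptedCoord_mul_right {n : ℕ} (U V : SU n) (A : Op n) :
    adaptedCoord (U * V) (A * (V : Op n)) = adaptedCoord U A := by
  have hV : (V : Op n) * (V : Op n)ᴴ = 1 :=
    Matrix.mem_unitaryGroup_iff.mp (Matrix.specialUnitaryGroup_le_unitaryGroup V.2)
  funext σ
  have h : pauli σ * (A * (V : Op n)) * ((U * V : SU n) : Op n)ᴴ = pauli σ * A * (U : Op n)ᴴ := by
    rw [Submonoid.coe_mul, Matrix.conjTranspose_mul]
    calc pauli σ * (A * (V : Op n)) * ((V : Op n)ᴴ * (U : Op n)ᴴ)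
        = pauli σ * A * ((V : Op n) * (V : Op n)ᴴ) * (U : Op n)ᴴ := by
          simp only [Matrix.mul_assoc]
      _ = _ := by rw [hV, Matrix.mul_one]
  rw [adaptedCoord, adaptedCoord, h]

/-- `ψ`, a homeomorphism of an open set of coordinates onto an open subset of `SU(2 ^ n)`, is the
inverse of a chart of the smooth submanifold `SU(2 ^ n)` of the space of matrices: it is smooth
into the matrices, with injective differential. -/
def IsSmoothParam {n : ℕ} (ψ : OpenPartialHomeomorph (Coord n) (SU n)) : Prop :=
  ContDiffOn ℝ ∞ (fun x => (ψ x : Op n)) ψ.source ∧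
    ∀ x ∈ ψ.source, Function.Injective (fderiv ℝ (fun x => (ψ x : Op n)) x)

/-- Minkowski norms: smooth away from the origin, positive, positively homogeneous, and with
strictly positive Hessian of `N² / 2` away from the origin. -/
structure IsMinkowskiNorm {n : ℕ} (N : Coord n → ℝ) : Prop where
  smooth : ContDiffOn ℝ ∞ N {0}ᶜ
  nonneg : ∀ y, 0 ≤ N y
  eq_zero_iff : ∀ y, N y = 0 ↔ y = 0
  homogeneous : ∀ (a : ℝ) (y : Coord n), 0 < a → N (a • y) = a * N y
  hessian_pos : ∀ y, y ≠ 0 → ∀ v, v ≠ 0 →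
    0 < (1 / 2 : ℝ) * fderiv ℝ (fun z => fderiv ℝ (fun w => N w ^ 2) z) y v v

/-- A Finsler metric on `SU(2 ^ n)`. The tangent vector at `U` with `U`-adapted coordinates `γ`,
that is, the tangent vector of `t ↦ exp(-i (γ · σ) t) U` at `t = 0`, has length `F U γ`. -/
structure FinslerMetric (n : ℕ) where
  toFun : SU n → Coord n → ℝ
  smooth : ∀ ψ : OpenPartialHomeomorph (Coord n) (SU n), IsSmoothParam ψ →
    ContDiffOn ℝ ∞ (fun p : Coord n × Coord n => toFun (ψ p.1) p.2) (ψ.source ×ˢ {0}ᶜ)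
  minkowski : ∀ U, IsMinkowskiNorm (toFun U)

/-- The length of the tangent vector `A ∈ T_U SU(2 ^ n)`. -/
def FinslerMetric.length {n : ℕ} (F : FinslerMetric n) (U : SU n) (A : Op n) : ℝ :=
  F.toFun U (adaptedCoord U A)

/-- `F (U V, A V) = F (U, A)` for all `A = -i H U ∈ T_U SU(2 ^ n)` and all `V`. -/
def FinslerMetric.IsRightInvariant {n : ℕ} (F : FinslerMetric n) : Prop :=
  ∀ (U V : SU n) (γ : Coord n),
    F.length (U * V) (-(Complex.I • (hamiltonian γ * (U : Op n))) * (V : Op n)) =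
      F.length U (-(Complex.I • (hamiltonian γ * (U : Op n))))

/-- Equivalently, the metric does not depend on the position in adapted coordinates. -/
theorem FinslerMetric.isRightInvariant_iff {n : ℕ} (F : FinslerMetric n) :
    F.IsRightInvariant ↔ ∀ U γ, F.toFun U γ = F.toFun 1 γ := by
  simp only [IsRightInvariant, length, adaptedCoord_mul_right, adaptedCoord_hamiltonian]
  constructor
  · intro h U γ
    simpa using h 1 U γ
  · intro h U V γ
    rw [h, h U]

/-- The metric depends only on the absolute values of the Pauli coefficients. -/
def FinslerMetric.IsPauliSymmetric {n : ℕ} (F : FinslerMetric n) : Prop :=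
  ∀ (U : SU n) (γ γ' : Coord n), (∀ σ, |γ σ| = |γ' σ|) → F.toFun U γ = F.toFun U γ'

/-- `F²` in the coordinates `x` given by `ψ` and the associated natural coordinates `y` of
tangent vectors. -/
def FinslerMetric.sqInCoord {n : ℕ} (F : FinslerMetric n)
    (ψ : OpenPartialHomeomorph (Coord n) (SU n)) (x y : Coord n) : ℝ :=
  F.length (ψ x) (fderiv ℝ (fun z => (ψ z : Op n)) x y) ^ 2

/-- A smooth curve `s : J → SU(2 ^ n)` on an interval `J` is a geodesic if in every coordinate
system it solves the geodesic equation `d/dt (∂F²/∂y^j) = ∂F²/∂x^j`, where `x` are the coordinates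
of the curve and `y = dx/dt`. -/
structure FinslerMetric.IsGeodesicOn {n : ℕ} (F : FinslerMetric n) (s : ℝ → SU n) (J : Set ℝ) :
    Prop where
  smooth : ContDiffOn ℝ ∞ (fun t => (s t : Op n)) J
  equation : ∀ ψ : OpenPartialHomeomorph (Coord n) (SU n), IsSmoothParam ψ →
    ∀ t ∈ J, s t ∈ ψ.target → ∀ j : PauliIndex n,
      let x : ℝ → Coord n := fun τ => ψ.symm (s τ)
      let y : ℝ → Coord n := fun τ => derivWithin x J τ
      HasDerivWithinAt
        (fun τ => fderiv ℝ (fun y' => F.sqInCoord ψ (x τ) y') (y τ) (Pi.single j 1))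
        (fderiv ℝ (fun x' => F.sqInCoord ψ x' (y t)) (x t) (Pi.single j 1)) J t

/-- The subgroup generated by the generalized Pauli matrices with labels `g 0, …, g (k - 1)`. -/
def generatedSubgroup {n k : ℕ} (g : Fin k → PauliIndex n) :
    Subgroup (Matrix.unitaryGroup (Qubits n) ℂ) :=
  Subgroup.closure (Set.range fun j => ⟨pauli (g j), pauliString_mem_unitaryGroup (g j).1⟩)

/-- The generalized Pauli matrix with label `σ` belongs to `S`, up to a sign. -/
def MemUpToSign {n : ℕ} (S : Subgroup (Matrix.unitaryGroup (Qubits n) ℂ)) (σ : PauliIndex n) :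
    Prop :=
  ∃ P ∈ S, (P : Op n) = pauli σ ∨ (P : Op n) = -pauli σ

end PauliFinsler

end

/-! Right-invariance turns `F²`, in any chart `ψ`, into `energy (frame ψ x y)`: a fixed function `E`
of the right logarithmic derivative `γ` of the curve. Let `p = dE(γ)` be the momentum. By the
Maurer–Cartan equation (`frame_structure_equation`) the geodesic equation becomes the Euler–Arnold
equation `p'(w) = p(bracket γ w)`, where `bracket` is `i[·,·]` in Pauli coordinates; see
`isGeodesicOn_of_eulerArnold` and `IsGeodesicOn.eulerArnold`.

Pauli symmetry makes `E` even in each coordinate, so `p` at `h` vanishes wherever `h` does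
(`fderiv_energy_single`). Read as a Hamiltonian, `p` then involves only the mutually commuting
Paulis of `H₀`. It therefore commutes with `H₀`, and cyclicity of the trace gives `p(bracket h w) =
0` (`fderiv_energy_bracket`). So `h` is an equilibrium, and the one-parameter subgroup, whose
velocity is constantly `h`, is a geodesic.

For uniqueness the equation is followed in the momentum rather than the velocity, since `dE` need
not be differentiable at `0`. Near `h` the momentum determines whether `γ = h`, and `p'` is bounded
by a multiple of the displacement of `p` (`eventually_eulerArnold_le`), so a velocity equal to `h`
at one time stays `h`. Constant velocity then forces the curve to be the one-parameter subgroup.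
Logarithmic charts (`expParam`) ensure that the geodesic equation can be used at every point. -/

noncomputable section

namespace PauliFinsler

/-! ### Norm structures on matrices. -/

/-- The operator norm on matrices, with the product topology in reducible form. -/
@[reducible] def opNormedRing (n : ℕ) : NormedRing (Op n) where
  toNorm := (Matrix.linftyOpNormedRing : NormedRing (Op n)).toNorm
  toRing := Matrix.instRing
  toMetricSpace := (Matrix.linftyOpNormedRing : NormedRing (Op n)).toMetricSpace.replaceTopology rfl
  dist_eq := (Matrix.linftyOpNormedRing : NormedRing (Op n)).dist_eq
  norm_mul_le := (Matrix.linftyOpNormedRing : NormedRing (Op n)).norm_mul_le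

@[reducible] def opNonUnitalNormedRing (n : ℕ) : NonUnitalNormedRing (Op n) :=
  (opNormedRing n).toNonUnitalNormedRing

@[reducible] def opSeminormedRing (n : ℕ) : SeminormedRing (Op n) :=
  (opNormedRing n).toSeminormedRing

@[reducible] def opNonUnitalSeminormedRing (n : ℕ) : NonUnitalSeminormedRing (Op n) :=
  (opNormedRing n).toNonUnitalNormedRing.toNonUnitalSeminormedRing

@[reducible] def opNormedAddCommGroup (n : ℕ) : NormedAddCommGroup (Op n) :=
  (opNormedRing n).toNonUnitalNormedRing.toNormedAddCommGroup

@[reducible] def opSeminormedAddCommGroup (n : ℕ) : SeminormedAddCommGroup (Op n) :=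
  (opNormedAddCommGroup n).toSeminormedAddCommGroup

attribute [local instance] opNormedRing opNonUnitalNormedRing opSeminormedRing
  opNonUnitalSeminormedRing opNormedAddCommGroup opSeminormedAddCommGroup

@[reducible] def opNormedAlgebra (n : ℕ) (R : Type*) [NormedField R] [NormedAlgebra R ℂ] :
    NormedAlgebra R (Op n) :=
  { Matrix.instAlgebra with
    norm_smul_le := (Matrix.linftyOpNormedAlgebra : NormedAlgebra R (Op n)).norm_smul_le }

attribute [local instance] opNormedAlgebra

@[reducible] def opNormedSpace (n : ℕ) (R : Type*) [NormedField R] [NormedAlgebra R ℂ] :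
    NormedSpace R (Op n) :=
  (opNormedAlgebra n R).toNormedSpace

attribute [local instance] opNormedSpace

variable {n : ℕ}

/-! ### Pauli expansions of Hermitian traceless matrices. -/

theorem pauliString_zero : pauliString (0 : Fin n → Fin 4) = 1 := by
  ext a b
  simp only [pauliString, Matrix.of_apply, Pi.zero_apply, pauli1, Matrix.cons_val_zero,
    Matrix.one_apply]
  by_cases hab : a = b
  · subst hab; simp
  · obtain ⟨i, hi⟩ := Function.ne_iff.mp hab
    rw [if_neg hab]
    exact Finset.prod_eq_zero (Finset.mem_univ i) (by simp [hi])

theorem trace_pauli (σ : PauliIndex n) : Matrix.trace (pauli σ) = 0 := by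
  have h := pauliString_mul_trace σ.1 0
  rwa [pauliString_zero, mul_one, if_neg σ.2] at h

theorem pauli1_conjTranspose (j : Fin 4) : (pauli1 j)ᴴ = pauli1 j := by
  ext a b
  fin_cases j <;> fin_cases a <;> fin_cases b <;> simp [pauli1]

theorem pauliString_conjTranspose (p : Fin n → Fin 4) : (pauliString p)ᴴ = pauliString p := by
  ext a b
  simp only [Matrix.conjTranspose_apply, pauliString, Matrix.of_apply, star_prod]
  refine Finset.prod_congr rfl fun i _ => ?_
  conv_rhs => rw [← pauli1_conjTranspose (p i)]
  rfl

theorem hamiltonian_conjTranspose (γ : Coord n) : (hamiltonian γ)ᴴ = hamiltonian γ := by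
  simp [hamiltonian, Matrix.conjTranspose_sum, Matrix.conjTranspose_smul, pauli,
    pauliString_conjTranspose]

theorem trace_hamiltonian (γ : Coord n) : Matrix.trace (hamiltonian γ) = 0 := by
  simp [hamiltonian, Matrix.trace_sum, Matrix.trace_smul, trace_pauli]

/-- The map `γ ↦ γ · σ` as a real linear map. -/
def hamiltonianL : Coord n →L[ℝ] Op n :=
  LinearMap.toContinuousLinearMap
    { toFun := hamiltonian
      map_add' := fun x y => by simp [hamiltonian, add_smul, Finset.sum_add_distrib]
      map_smul' := fun c x => by
        simp only [hamiltonian, Pi.smul_apply, smul_eq_mul, Complex.ofReal_mul, RingHom.id_apply,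
          Finset.smul_sum]
        refine Finset.sum_congr rfl fun σ _ => ?_
        rw [mul_smul, Complex.coe_smul] }

/-- The strings are orthogonal for the trace pairing; being `4 ^ n` in number, they also span. -/
theorem linearIndependent_pauliString :
    LinearIndependent ℂ (pauliString : (Fin n → Fin 4) → Op n) := by
  rw [Fintype.linearIndependent_iff]
  intro c hc p
  have h : Matrix.trace (pauliString p * ∑ q, c q • pauliString q) = c p * 2 ^ n := by
    simp only [Finset.mul_sum, Matrix.trace_sum, Matrix.mul_smul, Matrix.trace_smul,
      pauliString_mul_trace, smul_eq_mul, mul_ite, mul_zero]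
    simp
  rw [hc] at h
  simpa using h.symm

open scoped ComplexOrder in
/-- A matrix is determined by its traces against the tensor products of `I, X, Y, Z`. -/
theorem eq_zero_of_trace_pauliString (M : Op n)
    (h : ∀ p, Matrix.trace (pauliString p * M) = 0) : M = 0 := by
  have hspan : Submodule.span ℂ (Set.range (pauliString : (Fin n → Fin 4) → Op n)) = ⊤ := by
    apply linearIndependent_pauliString.span_eq_top_of_card_eq_finrank'
    simp [Module.finrank_matrix, ← mul_pow]
  have hall : ∀ N : Op n, Matrix.trace (N * M) = 0 := by
    intro N
    have hN : N ∈ Submodule.span ℂ (Set.range (pauliString : (Fin n → Fin 4) → Op n)) := by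
      rw [hspan]; trivial
    induction hN using Submodule.span_induction with
    | mem x hx => obtain ⟨p, rfl⟩ := hx; exact h p
    | zero => simp
    | add x y _ _ hx hy => rw [add_mul, Matrix.trace_add, hx, hy, add_zero]
    | smul c x _ hx => rw [smul_mul_assoc, Matrix.trace_smul, hx, smul_zero]
  exact Matrix.trace_conjTranspose_mul_self_eq_zero_iff.mp (hall Mᴴ)

theorem trace_pauli_mul_hamiltonian (γ : Coord n) (σ : PauliIndex n) :
    Matrix.trace (pauli σ * hamiltonian γ) = (γ σ : ℂ) * 2 ^ n := by
  simp only [hamiltonian, Finset.mul_sum, Matrix.trace_sum, Matrix.mul_smul, Matrix.trace_smul,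
    pauli, pauliString_mul_trace, smul_eq_mul, mul_ite, mul_zero, Subtype.coe_inj]
  simp

/-- A Hermitian traceless matrix is the Hamiltonian of its Pauli coefficients. -/
theorem eq_hamiltonian (M : Op n) (hM : Mᴴ = M) (htr : Matrix.trace M = 0) :
    M = hamiltonian fun σ => (Matrix.trace (pauli σ * M) / 2 ^ n).re := by
  rw [← sub_eq_zero]
  apply eq_zero_of_trace_pauliString
  intro p
  rw [mul_sub, Matrix.trace_sub]
  by_cases hp : p = 0
  · subst hp
    rw [pauliString_zero, one_mul, one_mul, htr, trace_hamiltonian, sub_zero]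
  · have hre : star (Matrix.trace (pauliString p * M)) = Matrix.trace (pauliString p * M) := by
      rw [← Matrix.trace_conjTranspose, Matrix.conjTranspose_mul, hM, pauliString_conjTranspose,
        Matrix.trace_mul_comm]
    have h2 := trace_pauli_mul_hamiltonian
      (fun σ => (Matrix.trace (pauli σ * M) / 2 ^ n).re) ⟨p, hp⟩
    simp only [pauli] at h2 ⊢
    rw [h2, sub_eq_zero]
    obtain ⟨r, hr⟩ := Complex.conj_eq_iff_real.mp hre
    rw [hr]
    have h3 : ((r : ℂ) / 2 ^ n) = ((r / 2 ^ n : ℝ) : ℂ) := by push_cast; rfl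
    rw [h3, Complex.ofReal_re, ← Complex.ofReal_ofNat, ← Complex.ofReal_pow, ← Complex.ofReal_mul]
    congr 1
    field_simp

/-- `adaptedCoord` as a real bilinear map of the tangent matrix and of the base point. -/
def adaptedCoordL : Op n →L[ℝ] Op n →L[ℝ] Coord n :=
  LinearMap.toContinuousBilinearMap <|
    LinearMap.mk₂ ℝ
      (fun A V σ => (Complex.I * Matrix.trace (pauli σ * A * Vᴴ) / 2 ^ n).re)
      (fun A A' V => by
        funext σ
        simp [mul_add, add_mul, add_div])
      (fun c A V => by
        funext σ
        simp only [Matrix.mul_smul, Matrix.smul_mul, Matrix.trace_smul, Pi.smul_apply, smul_eq_mul]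
        rw [mul_smul_comm, smul_div_assoc, Complex.smul_re, smul_eq_mul])
      (fun A V V' => by
        funext σ
        simp [mul_add, add_div])
      (fun c A V => by
        funext σ
        simp only [Matrix.conjTranspose_smul, star_trivial, Matrix.mul_smul, Matrix.trace_smul,
          Pi.smul_apply, smul_eq_mul]
        rw [mul_smul_comm, smul_div_assoc, Complex.smul_re, smul_eq_mul])

theorem adaptedCoordL_apply (A V : Op n) (σ : PauliIndex n) :
    adaptedCoordL A V σ = (Complex.I * Matrix.trace (pauli σ * A * Vᴴ) / 2 ^ n).re := rfl

theorem coe_mul_conjTranspose (U : SU n) : (U : Op n) * (U : Op n)ᴴ = 1 :=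
  Matrix.mem_unitaryGroup_iff.mp (Matrix.specialUnitaryGroup_le_unitaryGroup U.2)

theorem conjTranspose_mul_coe (U : SU n) : (U : Op n)ᴴ * (U : Op n) = 1 :=
  Matrix.mem_unitaryGroup_iff'.mp (Matrix.specialUnitaryGroup_le_unitaryGroup U.2)

/-! ### Tangent spaces and the determinant. -/

/-- `A` is tangent to `SU(2 ^ n)` at `U`. -/
def IsTangent (U : SU n) (A : Op n) : Prop :=
  A = -(Complex.I • (hamiltonian (adaptedCoord U A) * (U : Op n)))

/-- The hypotheses make `i A U†` Hermitian and traceless, hence a Hamiltonian, and its Pauli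
coefficients are by definition the adapted coordinates of `A`. -/
theorem isTangent_of_skew (U : SU n) (A : Op n)
    (h : A * (U : Op n)ᴴ + (U : Op n) * Aᴴ = 0) (htr : Matrix.trace (A * (U : Op n)ᴴ) = 0) :
    IsTangent U A := by
  have hM := eq_hamiltonian (Complex.I • (A * (U : Op n)ᴴ))
    (by
      rw [Matrix.conjTranspose_smul, Matrix.conjTranspose_mul, Matrix.conjTranspose_conjTranspose,
        eq_neg_of_add_eq_zero_right h]
      simp)
    (by rw [Matrix.trace_smul, htr, smul_zero])
  have hc : (fun σ => (Matrix.trace (pauli σ * Complex.I • (A * (U : Op n)ᴴ)) / 2 ^ n).re)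
      = adaptedCoord U A := by
    funext σ
    rw [adaptedCoord, Matrix.mul_smul, Matrix.trace_smul, smul_eq_mul, Matrix.mul_assoc]
  rw [hc] at hM
  rw [IsTangent, ← hM, smul_mul_assoc, smul_smul, Matrix.mul_assoc, conjTranspose_mul_coe]
  simp

theorem IsTangent.eq_zero {U : SU n} {A : Op n} (h : IsTangent U A) (h0 : adaptedCoord U A = 0) :
    A = 0 := by
  rw [h, h0]
  simp [hamiltonian]

theorem contDiff_det : ContDiff ℝ ∞ fun N : Op n => N.det := by
  simp only [Matrix.det_apply]
  refine ContDiff.sum fun τ _ => ContDiff.const_smul _ (contDiff_prod fun i _ => ?_)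
  exact (LinearMap.toContinuousLinearMap (Matrix.entryLinearMap ℝ ℂ (τ i) i)).contDiff

/-- The differential of the determinant at the identity is the trace. -/
theorem fderiv_det_one_apply (M : Op n) :
    fderiv ℝ (fun N : Op n => N.det) 1 M = Matrix.trace M := by
  have h1 : HasDerivAt (fun r : ℝ => (1 : Op n) + r • M) M 0 := by
    have := ((hasDerivAt_id (0 : ℝ)).smul_const M).const_add (1 : Op n)
    rwa [one_smul] at this
  have hd : DifferentiableAt ℝ (fun N : Op n => N.det) ((1 : Op n) + (0 : ℝ) • M) :=
    contDiff_det.differentiable (by simp) _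
  have h2 := hd.hasFDerivAt.comp_hasDerivAt (0 : ℝ) h1
  -- `det (1 + r M) = 1 + r tr M + r² q(r)` with `q` a polynomial; the last term has derivative zero
  -- at `r = 0`.
  have h3 : HasDerivAt (fun r : ℝ => (1 : ℂ) + Matrix.trace M * (r : ℂ)
      + (Matrix.det (1 + (Polynomial.X : Polynomial ℂ) • M.map Polynomial.C)).divX.divX.eval (r : ℂ)
        * (r : ℂ) ^ 2) (Matrix.trace M) 0 := by
    have hr : HasDerivAt (fun r : ℝ => (r : ℂ)) 1 0 := Complex.ofRealCLM.hasDerivAt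
    have hp := ((Polynomial.hasDerivAt
      (Matrix.det (1 + (Polynomial.X : Polynomial ℂ) • M.map Polynomial.C)).divX.divX
        ((0 : ℝ) : ℂ)).comp_ofReal)
    have := ((hr.const_mul (Matrix.trace M)).const_add 1).add (hp.mul (hr.pow 2))
    simp at this
    exact this
  have h4 : (fun N : Op n => N.det) ∘ (fun r : ℝ => (1 : Op n) + r • M) = (fun r : ℝ =>
      (1 : ℂ) + Matrix.trace M * (r : ℂ)
      + (Matrix.det (1 + (Polynomial.X : Polynomial ℂ) • M.map Polynomial.C)).divX.divX.eval (r : ℂ)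
        * (r : ℂ) ^ 2) := by
    funext r
    rw [Function.comp_apply, ← Complex.coe_smul, Matrix.det_one_add_smul]
  rw [h4] at h2
  simpa using h2.unique h3

/-- Multiplicativity, `det exp(rM) = det exp(tM) · det exp((r - t)M)`, moves the derivative at `t`
to the identity. -/
theorem hasDerivAt_det_exp (M : Op n) (t : ℝ) :
    HasDerivAt (fun r : ℝ => (NormedSpace.exp (r • M)).det)
      ((NormedSpace.exp (t • M)).det * Matrix.trace M) t := by
  have h0 : HasDerivAt (fun r : ℝ => (NormedSpace.exp ((r - t) • M)).det) (Matrix.trace M) t := by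
    have h1 : HasDerivAt (fun r : ℝ => NormedSpace.exp ((r - t) • M)) M t := by
      have := (hasDerivAt_exp_smul_const (𝕂 := ℝ) M (t - t))
      have h := HasDerivAt.scomp (h := fun x => x - t) t this ((hasDerivAt_id t).sub_const t)
      simpa [Function.comp_def] using h
    have hd : DifferentiableAt ℝ (fun N : Op n => N.det) (NormedSpace.exp ((t - t) • M)) :=
      contDiff_det.differentiable (by simp) _
    have h2 := hd.hasFDerivAt.comp_hasDerivAt t h1
    simpa [fderiv_det_one_apply, Function.comp_def] using h2
  have h := h0.const_mul (NormedSpace.exp (t • M)).det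
  refine h.congr_of_eventuallyEq (Filter.Eventually.of_forall fun r => ?_)
  have hc : Commute (t • M) ((r - t) • M) := ((Commute.refl M).smul_left t).smul_right (r - t)
  simp only
  rw [← Matrix.det_mul, ← NormedSpace.exp_add_of_commute hc, ← add_smul, add_sub_cancel]

theorem det_exp (M : Op n) : (NormedSpace.exp M).det = Complex.exp (Matrix.trace M) := by
  have h : ∀ t : ℝ, HasDerivAt
      (fun r : ℝ => (NormedSpace.exp (r • M)).det * Complex.exp (-((r : ℂ) * Matrix.trace M)))
      0 t := by
    intro t
    have hr : HasDerivAt (fun r : ℝ => (r : ℂ)) 1 t := Complex.ofRealCLM.hasDerivAt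
    have h2 := (hasDerivAt_det_exp M t).mul ((hr.mul_const (Matrix.trace M)).neg.cexp)
    convert! h2 using 1
    ring
  have hc := is_const_of_deriv_eq_zero (fun t => (h t).differentiableAt) (fun t => (h t).deriv) 1 0
  simp only [one_smul, Complex.ofReal_one, one_mul, zero_smul, NormedSpace.exp_zero, Matrix.det_one,
    Complex.ofReal_zero, zero_mul, neg_zero, Complex.exp_zero, Complex.exp_neg] at hc
  field_simp at hc
  exact hc

/-- The velocity of a curve in `SU(2 ^ n)` is tangent to `SU(2 ^ n)`. -/
theorem isTangent_of_hasDerivWithinAt {s : ℝ → SU n} {J : Set ℝ} {t : ℝ} {v : Op n}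
    (hJ : UniqueDiffWithinAt ℝ J t)
    (hs : HasDerivWithinAt (fun τ => (s τ : Op n)) v J t) : IsTangent (s t) v := by
  have hstar : HasDerivWithinAt (fun τ => (s τ : Op n)ᴴ) vᴴ J t := hs.star
  apply isTangent_of_skew
  · have h := hs.mul hstar
    have h' : HasDerivWithinAt ((fun τ => (s τ : Op n)) * fun τ => (s τ : Op n)ᴴ) 0 J t := by
      have : ((fun τ => (s τ : Op n)) * fun τ => (s τ : Op n)ᴴ) = fun _ => 1 := by
        funext τ; exact coe_mul_conjTranspose (s τ)
      rw [this]
      exact hasDerivWithinAt_const _ _ _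
    exact hJ.eq_deriv _ h h'
  · have h := hs.mul_const ((s t : Op n)ᴴ)
    have hd : DifferentiableAt ℝ (fun N : Op n => N.det) ((s t : Op n) * (s t : Op n)ᴴ) :=
      contDiff_det.differentiable (by simp) _
    have h2 := hd.hasFDerivAt.comp_hasDerivWithinAt t h
    have h3 : ((fun N : Op n => N.det) ∘ fun τ => (s τ : Op n) * (s t : Op n)ᴴ) = fun _ => 1 := by
      funext τ
      have h4 := (Matrix.mem_specialUnitaryGroup_iff.mp (s τ).2).2
      have h5 := (Matrix.mem_specialUnitaryGroup_iff.mp (s t).2).2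
      simp [Matrix.det_conjTranspose, h4, h5]
    rw [h3, coe_mul_conjTranspose, fderiv_det_one_apply] at h2
    exact hJ.eq_deriv _ h2 (hasDerivWithinAt_const _ _ _)

/-! ### Charts, the logarithmic derivative and the Maurer–Cartan equation. -/

/-- The Lie bracket of `su(2 ^ n)` in Pauli coordinates, up to sign. -/
def bracket : Coord n →L[ℝ] Coord n →L[ℝ] Coord n :=
  LinearMap.toContinuousBilinearMap <|
    LinearMap.mk₂ ℝ
      (fun u v => adaptedCoordL
        (hamiltonianL u * hamiltonianL v - hamiltonianL v * hamiltonianL u) 1)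
      (fun u u' v => by
        rw [← add_apply, ← map_add, map_add]; congr 2; noncomm_ring)
      (fun c u v => by
        rw [← smul_apply, ← map_smul, map_smul, smul_mul_assoc,
          mul_smul_comm, smul_sub])
      (fun u v v' => by
        rw [← add_apply, ← map_add, map_add]; congr 2; noncomm_ring)
      (fun c u v => by
        rw [← smul_apply, ← map_smul, map_smul, smul_mul_assoc,
          mul_smul_comm, smul_sub])

theorem bracket_apply (u v : Coord n) :
    bracket u v = adaptedCoordL (hamiltonian u * hamiltonian v - hamiltonian v * hamiltonian u) 1 :=
  rfl

/-- The right logarithmic derivative of a parametrization, in Pauli coordinates. -/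
def frame (ψ : OpenPartialHomeomorph (Coord n) (SU n)) (x : Coord n) : Coord n →L[ℝ] Coord n :=
  (adaptedCoordL.flip (ψ x : Op n)) ∘L fderiv ℝ (fun z => (ψ z : Op n)) x

theorem frame_apply (ψ : OpenPartialHomeomorph (Coord n) (SU n)) (x y : Coord n) :
    frame ψ x y = adaptedCoord (ψ x) (fderiv ℝ (fun z => (ψ z : Op n)) x y) := rfl

namespace IsSmoothParam

variable {ψ : OpenPartialHomeomorph (Coord n) (SU n)} {x : Coord n}

theorem contDiffAt (hψ : IsSmoothParam ψ) (hx : x ∈ ψ.source) :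
    ContDiffAt ℝ ∞ (fun z => (ψ z : Op n)) x := by
  have h : ContDiffOn ℝ ∞ (fun z => (ψ z : Op n)) ψ.source := hψ.1
  exact h.contDiffAt (ψ.open_source.mem_nhds hx)

theorem hasFDerivAt (hψ : IsSmoothParam ψ) (hx : x ∈ ψ.source) :
    HasFDerivAt (fun z => (ψ z : Op n)) (fderiv ℝ (fun z => (ψ z : Op n)) x) x :=
  ((hψ.contDiffAt hx).differentiableAt (by simp)).hasFDerivAt

theorem isTangent (hψ : IsSmoothParam ψ) (hx : x ∈ ψ.source) (y : Coord n) :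
    IsTangent (ψ x) (fderiv ℝ (fun z => (ψ z : Op n)) x y) := by
  have h1 : HasDerivAt (fun t : ℝ => x + t • y) y 0 := by
    have := ((hasDerivAt_id (0 : ℝ)).smul_const y).const_add x
    rwa [one_smul] at this
  have h0 : x + (0 : ℝ) • y = x := by simp
  have h2 : HasFDerivAt (fun z => (ψ z : Op n)) (fderiv ℝ (fun z => (ψ z : Op n)) x)
      (x + (0 : ℝ) • y) := by rw [h0]; exact hψ.hasFDerivAt hx
  have h3 := h2.comp_hasDerivAt (0 : ℝ) h1
  have h4 := isTangent_of_hasDerivWithinAt (s := fun t : ℝ => ψ (x + t • y))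
    uniqueDiffWithinAt_univ h3.hasDerivWithinAt
  simpa only [h0] using h4

theorem frame_injective (hψ : IsSmoothParam ψ) (hx : x ∈ ψ.source) :
    Function.Injective (frame ψ x) := by
  rw [injective_iff_map_eq_zero]
  intro y hy
  have h := (hψ.isTangent hx y).eq_zero hy
  exact (injective_iff_map_eq_zero _).mp (hψ.2 x hx) y h

theorem isUnit_frame (hψ : IsSmoothParam ψ) (hx : x ∈ ψ.source) : IsUnit (frame ψ x) := by
  rw [ContinuousLinearMap.isUnit_iff_bijective]
  have h := hψ.frame_injective hx
  exact ⟨h, (LinearMap.injective_iff_surjective (f := (frame ψ x : Coord n →ₗ[ℝ] Coord n))).mp h⟩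

/-- The formula isolates the second derivative of `ψ`, whose symmetry removes it from the
Maurer–Cartan equation. -/
theorem hasFDerivAt_frame_apply (hψ : IsSmoothParam ψ) (hx : x ∈ ψ.source) :
    ∃ D : Coord n →L[ℝ] Coord n →L[ℝ] Coord n, HasFDerivAt (frame ψ) D x ∧
      ∀ e y, D e y = adaptedCoordL (fderiv ℝ (fderiv ℝ (fun z => (ψ z : Op n))) x e y) (ψ x : Op n)
        + adaptedCoordL (fderiv ℝ (fun z => (ψ z : Op n)) x y)
          (fderiv ℝ (fun z => (ψ z : Op n)) x e) := by
  have h1 := hψ.hasFDerivAt hx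
  have h2 : HasFDerivAt (fderiv ℝ (fun z => (ψ z : Op n)))
      (fderiv ℝ (fderiv ℝ (fun z => (ψ z : Op n))) x) x :=
    (((hψ.contDiffAt hx).fderiv_right (m := ∞) le_rfl).differentiableAt
      (by simp)).hasFDerivAt
  have h3 := ((adaptedCoordL (n := n)).flip.hasFDerivAt.comp x h1).clm_comp h2
  refine ⟨_, h3, fun e y => ?_⟩
  simp

/-- The Maurer–Cartan equation. -/
theorem frame_structure_equation (hψ : IsSmoothParam ψ) (hx : x ∈ ψ.source) (e y : Coord n) :
    fderiv ℝ (frame ψ) x e y - fderiv ℝ (frame ψ) x y e =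
      bracket (frame ψ x y) (frame ψ x e) := by
  obtain ⟨D, hD, hDe⟩ := hψ.hasFDerivAt_frame_apply hx
  have hsymm : IsSymmSndFDerivAt ℝ (fun z => (ψ z : Op n)) x :=
    (hψ.contDiffAt hx).isSymmSndFDerivAt
      (by rw [minSmoothness_of_isRCLikeNormedField]; exact WithTop.coe_le_coe.mpr le_top)
  rw [hD.fderiv, hDe, hDe, hsymm.eq e y, add_sub_add_left_eq_sub]
  -- With `dψ(u) = -i H_u U` and `dψ(v) = -i H_v U`, unitarity of `U` gives `dψ(u) dψ(v)† = H_u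
  -- H_v`.
  have key : ∀ u v : Coord n, adaptedCoordL (fderiv ℝ (fun z => (ψ z : Op n)) x u)
      (fderiv ℝ (fun z => (ψ z : Op n)) x v) =
      adaptedCoordL (hamiltonian (frame ψ x u) * hamiltonian (frame ψ x v)) 1 := by
    intro u v
    have h1 := hψ.isTangent hx u
    have h2 := hψ.isTangent hx v
    rw [IsTangent, ← frame_apply] at h1 h2
    have h3 : fderiv ℝ (fun z => (ψ z : Op n)) x u * (fderiv ℝ (fun z => (ψ z : Op n)) x v)ᴴ
        = hamiltonian (frame ψ x u) * hamiltonian (frame ψ x v) := by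
      rw [h1, h2]
      simp only [Matrix.conjTranspose_neg, Matrix.conjTranspose_smul, Matrix.conjTranspose_mul,
        hamiltonian_conjTranspose, neg_mul_neg, smul_mul_smul_comm]
      rw [Matrix.mul_assoc, ← Matrix.mul_assoc (ψ x : Op n), coe_mul_conjTranspose, Matrix.one_mul]
      simp
    funext σ
    rw [adaptedCoordL_apply, adaptedCoordL_apply, Matrix.mul_assoc, h3, Matrix.conjTranspose_one,
      Matrix.mul_one]
  rw [key, key, bracket_apply, map_sub, sub_apply]

/-- Coordinates of a differentiable curve are differentiable. -/
theorem exists_hasDerivWithinAt_symm (hψ : IsSmoothParam ψ) {s : ℝ → SU n} {J : Set ℝ} {t : ℝ}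
    {v : Op n} (hJ : UniqueDiffWithinAt ℝ J t) (htJ : t ∈ J) (ht : s t ∈ ψ.target)
    (hs : HasDerivWithinAt (fun τ => (s τ : Op n)) v J t) :
    ∃ y, HasDerivWithinAt (fun τ => ψ.symm (s τ)) y J t ∧
      fderiv ℝ (fun z => (ψ z : Op n)) (ψ.symm (s t)) y = v := by
  set x := ψ.symm (s t) with hx
  have hxs : x ∈ ψ.source := ψ.map_target ht
  have hψx : ψ x = s t := ψ.right_inv ht
  have hsc : ContinuousWithinAt s J t := tendsto_subtype_rng.mpr hs.continuousWithinAt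
  have hxc : ContinuousWithinAt (fun τ => ψ.symm (s τ)) J t :=
    (ψ.continuousAt_symm ht).comp_continuousWithinAt hsc
  have hst : HasStrictFDerivAt (fun z => (ψ z : Op n)) (fderiv ℝ (fun z => (ψ z : Op n)) x) x :=
    (hψ.contDiffAt hxs).hasStrictFDerivAt (by simp)
  -- Composing with a linear left inverse `ℓ` of `dψ` gives a map between spaces of equal dimension
  -- with derivative the identity. Its local inverse, applied to `ℓ ∘ s`, is the coordinate curve.
  obtain ⟨l, hl⟩ := LinearMap.exists_leftInverse_of_injective
    (fderiv ℝ (fun z => (ψ z : Op n)) x : Coord n →ₗ[ℝ] Op n)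
    (LinearMap.ker_eq_bot.mpr (hψ.2 x hxs))
  set ℓ : Op n →L[ℝ] Coord n := LinearMap.toContinuousLinearMap l
  have hℓ : ∀ y, ℓ (fderiv ℝ (fun z => (ψ z : Op n)) x y) = y := fun y => LinearMap.congr_fun hl y
  have hcomp : HasStrictFDerivAt (fun z => ℓ (ψ z : Op n))
      ((ContinuousLinearEquiv.refl ℝ (Coord n) : Coord n ≃L[ℝ] Coord n) :
        Coord n →L[ℝ] Coord n) x := by
    have h := ℓ.hasStrictFDerivAt.comp x hst
    convert! h using 1
    ext1 y
    exact (hℓ y).symm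
  have hinv := hcomp.to_localInverse.hasFDerivAt
  have hev := hcomp.eventually_left_inverse
  have hℓs := (ℓ.hasFDerivAt (x := (s t : Op n))).comp_hasDerivWithinAt t hs
  have hinv' : HasFDerivAt (hcomp.localInverse _ _ _)
      ((ContinuousLinearEquiv.refl ℝ (Coord n)).symm : Coord n →L[ℝ] Coord n) (ℓ (s t : Op n)) := by
    rw [← hψx]; exact hinv
  have hd := hinv'.comp_hasDerivWithinAt t hℓs
  have hxd : HasDerivWithinAt (fun τ => ψ.symm (s τ)) (ℓ v) J t := by
    refine hd.congr_of_eventuallyEq_of_mem ?_ htJ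
    have htgt : ∀ᶠ τ in nhdsWithin t J, s τ ∈ ψ.target :=
      hsc (ψ.open_target.mem_nhds ht)
    filter_upwards [hxc.eventually hev, htgt] with τ h1 h2
    rw [ψ.right_inv h2] at h1
    exact h1.symm
  refine ⟨ℓ v, hxd, ?_⟩
  have hc := (hψ.hasFDerivAt hxs).comp_hasDerivWithinAt t hxd
  refine hJ.eq_deriv _ ?_ hs
  refine hc.congr_of_eventuallyEq_of_mem ?_ htJ
  filter_upwards [hsc (ψ.open_target.mem_nhds ht)] with τ hτ
  exact congrArg _ (ψ.right_inv hτ).symm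

end IsSmoothParam

/-! ### The geodesic equation as the Euler–Arnold equation. -/

/-- The squared length of tangent vectors at the identity. -/
def FinslerMetric.energy (F : FinslerMetric n) (γ : Coord n) : ℝ := F.toFun 1 γ ^ 2

/-- The velocity of a curve in `SU(2 ^ n)`, in adapted coordinates. -/
def velocity (s : ℝ → SU n) (J : Set ℝ) (t : ℝ) : Coord n :=
  adaptedCoord (s t) (derivWithin (fun τ => (s τ : Op n)) J t)

namespace FinslerMetric

variable {F : FinslerMetric n}

theorem sqInCoord_eq (hF : F.IsRightInvariant) (ψ : OpenPartialHomeomorph (Coord n) (SU n))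
    (x y : Coord n) : F.sqInCoord ψ x y = F.energy (frame ψ x y) := by
  rw [sqInCoord, length, (F.isRightInvariant_iff.mp hF), energy, frame_apply]

theorem fderiv_sqInCoord_vel (hF : F.IsRightInvariant) (hL : Differentiable ℝ F.energy)
    (ψ : OpenPartialHomeomorph (Coord n) (SU n)) (x y e : Coord n) :
    fderiv ℝ (fun y' => F.sqInCoord ψ x y') y e =
      fderiv ℝ F.energy (frame ψ x y) (frame ψ x e) := by
  simp only [sqInCoord_eq hF]
  have h := (hL (frame ψ x y)).hasFDerivAt.comp y (frame ψ x).hasFDerivAt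
  have h2 : fderiv ℝ (fun y' => F.energy (frame ψ x y')) y = _ := h.fderiv
  rw [h2]
  rfl

theorem fderiv_sqInCoord_pos (hF : F.IsRightInvariant) (hL : Differentiable ℝ F.energy)
    {ψ : OpenPartialHomeomorph (Coord n) (SU n)} (hψ : IsSmoothParam ψ) {x : Coord n}
    (hx : x ∈ ψ.source) (y e : Coord n) :
    fderiv ℝ (fun x' => F.sqInCoord ψ x' y) x e =
      fderiv ℝ F.energy (frame ψ x y) (fderiv ℝ (frame ψ) x e y) := by
  simp only [sqInCoord_eq hF]
  obtain ⟨D, hD, -⟩ := hψ.hasFDerivAt_frame_apply hx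
  have h := (hL (frame ψ x y)).hasFDerivAt.comp x
    (hD.clm_apply (hasFDerivAt_const y x))
  have h2 : fderiv ℝ (fun x' => F.energy (frame ψ x' y)) x = _ := h.fderiv
  rw [h2, hD.fderiv]
  simp

end FinslerMetric

/-- The data of a differentiable curve in a chart. -/
theorem IsSmoothParam.frame_derivWithin {ψ : OpenPartialHomeomorph (Coord n) (SU n)}
    (hψ : IsSmoothParam ψ) {s : ℝ → SU n} {J : Set ℝ} {t : ℝ}
    (hJ : UniqueDiffWithinAt ℝ J t) (htJ : t ∈ J) (ht : s t ∈ ψ.target)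
    (hs : DifferentiableWithinAt ℝ (fun τ => (s τ : Op n)) J t) :
    DifferentiableWithinAt ℝ (fun τ => ψ.symm (s τ)) J t ∧
      frame ψ (ψ.symm (s t)) (derivWithin (fun τ => ψ.symm (s τ)) J t) = velocity s J t := by
  obtain ⟨y, hy, hyv⟩ := hψ.exists_hasDerivWithinAt_symm hJ htJ ht hs.hasDerivWithinAt
  refine ⟨hy.differentiableWithinAt, ?_⟩
  rw [hy.derivWithin hJ, frame_apply, hyv, ψ.right_inv ht, velocity]

namespace FinslerMetric

variable {F : FinslerMetric n}

/-- The left-hand side of the geodesic equation in terms of the momentum. -/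
theorem eventually_fderiv_sqInCoord_vel (hF : F.IsRightInvariant) (hL : Differentiable ℝ F.energy)
    {ψ : OpenPartialHomeomorph (Coord n) (SU n)} (hψ : IsSmoothParam ψ) {s : ℝ → SU n} {J : Set ℝ}
    {t : ℝ} (hJ : UniqueDiffOn ℝ J) (htJ : t ∈ J) (ht : s t ∈ ψ.target)
    (hs : DifferentiableOn ℝ (fun τ => (s τ : Op n)) J) :
    ∀ᶠ τ in nhdsWithin t J, ∀ e : Coord n,
      fderiv ℝ (fun y' => F.sqInCoord ψ (ψ.symm (s τ)) y')
        (derivWithin (fun τ => ψ.symm (s τ)) J τ) e =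
      fderiv ℝ F.energy (velocity s J τ) (frame ψ (ψ.symm (s τ)) e) := by
  have hsc : ContinuousWithinAt s J t := tendsto_subtype_rng.mpr (hs t htJ).continuousWithinAt
  filter_upwards [hsc (ψ.open_target.mem_nhds ht), self_mem_nhdsWithin] with τ hτ hτJ e
  rw [fderiv_sqInCoord_vel hF hL, (hψ.frame_derivWithin (hJ τ hτJ) hτJ hτ (hs τ hτJ)).2]

/-- A curve whose momentum solves the Euler–Arnold equation is a geodesic. -/
theorem isGeodesicOn_of_eulerArnold (hF : F.IsRightInvariant) (hL : Differentiable ℝ F.energy)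
    {s : ℝ → SU n} {J : Set ℝ} (hJ : UniqueDiffOn ℝ J)
    (hs : ContDiffOn ℝ ∞ (fun τ => (s τ : Op n)) J)
    (P : ℝ → Coord n →L[ℝ] ℝ)
    (hP : ∀ t ∈ J, HasDerivWithinAt (fun τ => fderiv ℝ F.energy (velocity s J τ)) (P t) J t)
    (heq : ∀ t ∈ J, ∀ w, P t w =
      fderiv ℝ F.energy (velocity s J t) (bracket (velocity s J t) w)) :
    F.IsGeodesicOn s J where
  smooth := hs
  equation := by
    intro ψ hψ t htJ ht j
    have hsd := hs.differentiableOn (by simp)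
    obtain ⟨hx, hfr⟩ := hψ.frame_derivWithin (hJ t htJ) htJ ht (hsd t htJ)
    have hxs := ψ.map_target ht
    obtain ⟨D, hD, -⟩ := hψ.hasFDerivAt_frame_apply hxs
    have hA : HasDerivWithinAt (fun τ => frame ψ (ψ.symm (s τ)))
        (D (derivWithin (fun τ => ψ.symm (s τ)) J t)) J t :=
      hD.comp_hasDerivWithinAt (f := fun τ => ψ.symm (s τ)) t hx.hasDerivWithinAt
    have hq := (hP t htJ).clm_apply
      (hA.clm_apply (hasDerivWithinAt_const t J (Pi.single j 1 : Coord n)))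
    have hev := eventually_fderiv_sqInCoord_vel hF hL hψ hJ htJ ht hsd
    have hq' := hq.congr_of_eventuallyEq_of_mem (hev.mono fun τ h => h (Pi.single j 1)) htJ
    refine hq'.congr_deriv ?_
    -- The product rule gives `P(A e) + p(D y e)` with `A` the frame, and Maurer–Cartan makes `P(A
    -- e) = p(D e y - D y e)`, leaving `p(D e y)`.
    rw [fderiv_sqInCoord_pos hF hL hψ hxs, heq t htJ, ← hfr, ← hψ.frame_structure_equation hxs,
      map_sub, hD.fderiv]
    simp

/-- The momentum of a geodesic solves the Euler–Arnold equation. -/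
theorem IsGeodesicOn.eulerArnold (hF : F.IsRightInvariant) (hL : Differentiable ℝ F.energy)
    {s : ℝ → SU n} {J : Set ℝ} (hs : F.IsGeodesicOn s J) (hJ : UniqueDiffOn ℝ J)
    {ψ : OpenPartialHomeomorph (Coord n) (SU n)} (hψ : IsSmoothParam ψ) {t : ℝ}
    (htJ : t ∈ J) (ht : s t ∈ ψ.target) :
    HasDerivWithinAt (fun τ => fderiv ℝ F.energy (velocity s J τ))
      ((fderiv ℝ F.energy (velocity s J t)).comp (bracket (velocity s J t))) J t := by
  have hsm : ContDiffOn ℝ ∞ (fun τ => (s τ : Op n)) J := hs.smooth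
  have hsd := hsm.differentiableOn (by simp)
  obtain ⟨hx, hfr⟩ := hψ.frame_derivWithin (hJ t htJ) htJ ht (hsd t htJ)
  have hxs := ψ.map_target ht
  obtain ⟨D, hD, -⟩ := hψ.hasFDerivAt_frame_apply hxs
  have hA : HasDerivWithinAt (fun τ => frame ψ (ψ.symm (s τ)))
      (D (derivWithin (fun τ => ψ.symm (s τ)) J t)) J t :=
    hD.comp_hasDerivWithinAt (f := fun τ => ψ.symm (s τ)) t hx.hasDerivWithinAt
  have hev := eventually_fderiv_sqInCoord_vel hF hL hψ hJ htJ ht hsd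
  have hq : HasDerivWithinAt
      (fun τ => (fderiv ℝ F.energy (velocity s J τ)).comp (frame ψ (ψ.symm (s τ))))
      (∑ j, (fderiv ℝ F.energy (velocity s J t)
        (D (Pi.single j 1) (derivWithin (fun τ => ψ.symm (s τ)) J t))) •
          (ContinuousLinearMap.proj j : Coord n →L[ℝ] ℝ)) J t := by
    have h1 : (fun τ => (fderiv ℝ F.energy (velocity s J τ)).comp (frame ψ (ψ.symm (s τ)))) =
        fun τ => ∑ j, (fderiv ℝ F.energy (velocity s J τ)
          (frame ψ (ψ.symm (s τ)) (Pi.single j 1))) •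
          (ContinuousLinearMap.proj j : Coord n →L[ℝ] ℝ) := by
      funext τ
      ext v
      conv_lhs => rw [← Finset.univ_sum_single v]
      simp only [map_sum, sum_apply]
      refine Finset.sum_congr rfl fun j _ => ?_
      have : (Pi.single j (v j) : Coord n) = v j • Pi.single j 1 := by
        rw [← Pi.single_smul, smul_eq_mul, mul_one]
      rw [this, map_smul]
      simp [mul_comm]
    rw [h1]
    refine HasDerivWithinAt.fun_sum fun j _ => ?_
    have h2 := hs.equation ψ hψ t htJ ht j
    have h3 := h2.congr_of_eventuallyEq_of_mem (hev.mono fun τ h => (h (Pi.single j 1)).symm) htJ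
    rw [fderiv_sqInCoord_pos hF hL hψ hxs, hfr, hD.fderiv] at h3
    exact h3.smul_const (ContinuousLinearMap.proj j : Coord n →L[ℝ] ℝ)
  -- The chain rule cannot show `p` differentiable, because `dE` may fail to be so at zero velocity.
  -- Instead `p = (p ∘ A) ∘ A⁻¹`, where `p ∘ A` is differentiable by the geodesic equation.
  have hAi : DifferentiableWithinAt ℝ (fun τ => Ring.inverse (frame ψ (ψ.symm (s τ)))) J t :=
    (differentiableAt_inverse (𝕜 := ℝ) (hψ.isUnit_frame hxs)).comp_differentiableWithinAt
      (f := fun τ => frame ψ (ψ.symm (s τ))) t hA.differentiableWithinAt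
  have hp : DifferentiableWithinAt ℝ (fun τ => fderiv ℝ F.energy (velocity s J τ)) J t := by
    have h1 := hq.differentiableWithinAt.clm_comp hAi
    refine h1.congr_of_eventuallyEq_of_mem ?_ htJ
    have hsc : ContinuousWithinAt s J t := tendsto_subtype_rng.mpr (hsd t htJ).continuousWithinAt
    filter_upwards [hsc (ψ.open_target.mem_nhds ht)] with τ hτ
    have hu := Ring.mul_inverse_cancel _ (hψ.isUnit_frame (ψ.map_target hτ))
    change _ = ((fderiv ℝ F.energy (velocity s J τ)).comp (frame ψ (ψ.symm (s τ)))).comp _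
    rw [ContinuousLinearMap.comp_assoc, ← ContinuousLinearMap.mul_def, hu]
    rfl
  have hpd := hp.hasDerivWithinAt
  refine hpd.congr_deriv ?_
  set p' := derivWithin (fun τ => fderiv ℝ F.energy (velocity s J τ)) J t
  have hprod := hpd.clm_comp hA
  -- The derivative of `p ∘ A` from the geodesic equation agrees with that from the product rule,
  -- which determines `p'` on the range of `A`.
  have huniq := (hJ t htJ).eq_deriv _ hq hprod
  ext1 w
  obtain ⟨e, rfl⟩ := ((ContinuousLinearMap.isUnit_iff_bijective).mp (hψ.isUnit_frame hxs)).2 w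
  have h4 := DFunLike.congr_fun huniq e
  have h5 : ∑ j, e j • fderiv ℝ F.energy (velocity s J t)
        (D (Pi.single j 1) (derivWithin (fun τ => ψ.symm (s τ)) J t)) =
      fderiv ℝ F.energy (velocity s J t)
        (D e (derivWithin (fun τ => ψ.symm (s τ)) J t)) := by
    conv_rhs => rw [← Finset.univ_sum_single e]
    simp only [map_sum, sum_apply]
    refine Finset.sum_congr rfl fun j _ => ?_
    have : (Pi.single j (e j) : Coord n) = e j • Pi.single j 1 := by
      rw [← Pi.single_smul, smul_eq_mul, mul_one]
    rw [this, map_smul, smul_apply, map_smul]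
  rw [ContinuousLinearMap.comp_apply, ← hfr, ← hψ.frame_structure_equation hxs, map_sub, hfr,
    hD.fderiv, ← h5]
  simp only [sum_apply, smul_apply, ContinuousLinearMap.proj_apply, smul_eq_mul,
    add_apply, ContinuousLinearMap.comp_apply] at h4 ⊢
  rw [Finset.sum_congr rfl fun j _ => mul_comm (e j) _, h4]
  ring

end FinslerMetric

/-! ### Logarithmic charts of `SU(2 ^ n)`. -/

/-- The map `γ ↦ -i γ · σ`. -/
def skewL : Coord n →L[ℝ] Op n := -(Complex.I • hamiltonianL)

theorem skewL_apply (γ : Coord n) : skewL γ = -(Complex.I • hamiltonian γ) := rfl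

theorem skewL_conjTranspose (γ : Coord n) : (skewL γ)ᴴ = -skewL γ := by
  simp [skewL_apply, Matrix.conjTranspose_smul, hamiltonian_conjTranspose]

theorem adaptedCoord_skewL_mul (U : SU n) (γ : Coord n) :
    adaptedCoord U (skewL γ * (U : Op n)) = γ := by
  rw [skewL_apply, neg_mul, smul_mul_assoc, adaptedCoord_hamiltonian]

theorem adaptedCoord_one_skewL (γ : Coord n) : adaptedCoord 1 (skewL γ) = γ := by
  simpa using adaptedCoord_skewL_mul 1 γ

theorem exp_skewL_mem (γ : Coord n) :
    NormedSpace.exp (skewL γ) ∈ Matrix.specialUnitaryGroup (Qubits n) ℂ := by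
  rw [Matrix.mem_specialUnitaryGroup_iff]
  constructor
  · exact NormedSpace.exp_mem_unitary_of_mem_skewAdjoint
      (skewAdjoint.mem_iff.mpr (skewL_conjTranspose γ))
  · rw [det_exp, skewL_apply, Matrix.trace_neg, Matrix.trace_smul, trace_hamiltonian]
    simp

theorem contDiff_exp : ContDiff ℝ ∞ (NormedSpace.exp : Op n → Op n) :=
  contDiff_iff_contDiffAt.mpr fun M => (NormedSpace.exp_analytic (𝕂 := ℝ) M).contDiffAt

theorem fderiv_exp_zero :
    fderiv ℝ (NormedSpace.exp : Op n → Op n) 0 = 1 :=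
  (hasStrictFDerivAt_exp_zero (𝕂 := ℝ) (𝔸 := Op n)).hasFDerivAt.fderiv

/-- The exponential map of matrices as a local homeomorphism near the origin. -/
def expLocalHomeo (n : ℕ) : OpenPartialHomeomorph (Op n) (Op n) :=
  HasStrictFDerivAt.toOpenPartialHomeomorph (NormedSpace.exp : Op n → Op n)
    (f' := ContinuousLinearEquiv.refl ℝ (Op n)) (a := 0)
    (hasStrictFDerivAt_exp_zero (𝕂 := ℝ) (𝔸 := Op n))

theorem expLocalHomeo_apply (M : Op n) : expLocalHomeo n M = NormedSpace.exp M := rfl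

theorem zero_mem_expLocalHomeo_source : (0 : Op n) ∈ (expLocalHomeo n).source :=
  HasStrictFDerivAt.mem_toOpenPartialHomeomorph_source
    (f' := ContinuousLinearEquiv.refl ℝ (Op n))
    (hasStrictFDerivAt_exp_zero (𝕂 := ℝ) (𝔸 := Op n))

/-- A neighbourhood of the origin on which the exponential map restricts to a chart of
`SU(2 ^ n)`. -/
def logDomain (n : ℕ) : Set (Op n) :=
  {M | M ∈ (expLocalHomeo n).source ∧ -Mᴴ ∈ (expLocalHomeo n).source ∧
    ‖fderiv ℝ (NormedSpace.exp : Op n → Op n) M - 1‖ < 1 ∧ ‖Matrix.trace M‖ < 2 * Real.pi}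

theorem isOpen_logDomain : IsOpen (logDomain n) := by
  have h1 : Continuous fun M : Op n => -Mᴴ := continuous_star.neg
  have h2 : Continuous fun M : Op n => ‖fderiv ℝ (NormedSpace.exp : Op n → Op n) M - 1‖ :=
    ((contDiff_exp.continuous_fderiv (by simp)).sub continuous_const).norm
  have h3 : Continuous fun M : Op n => ‖Matrix.trace M‖ := continuous_id.matrix_trace.norm
  exact (expLocalHomeo n).open_source.inter
    (((expLocalHomeo n).open_source.preimage h1).inter
      ((isOpen_lt h2 continuous_const).inter (isOpen_lt h3 continuous_const)))

theorem zero_mem_logDomain : (0 : Op n) ∈ logDomain n := by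
  refine ⟨zero_mem_expLocalHomeo_source, ?_, ?_, ?_⟩
  · simpa using zero_mem_expLocalHomeo_source
  · simp [fderiv_exp_zero]
  · simpa using Real.pi_pos

/-- Near the origin, only elements of `su(2 ^ n)` have their exponential in `SU(2 ^ n)`. -/
theorem eq_skewL_of_exp_mem {M : Op n} (hM : M ∈ logDomain n)
    (h : NormedSpace.exp M ∈ Matrix.specialUnitaryGroup (Qubits n) ℂ) :
    skewL (adaptedCoord 1 M) = M := by
  obtain ⟨h1, h2, -, h4⟩ := hM
  obtain ⟨hU, hdet⟩ := Matrix.mem_specialUnitaryGroup_iff.mp h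
  -- Unitarity says `exp(-M†) = exp M`, and `exp` is injective on a set containing both arguments.
  have hskew : -Mᴴ = M := by
    refine (expLocalHomeo n).injOn h2 h1 ?_
    rw [expLocalHomeo_apply, expLocalHomeo_apply, ← Ring.inverse_exp]
    have h5 : NormedSpace.exp Mᴴ = (NormedSpace.exp M)ᴴ := (NormedSpace.star_exp M).symm
    have h6 : (NormedSpace.exp M)ᴴ * NormedSpace.exp M = 1 := Matrix.mem_unitaryGroup_iff'.mp hU
    have h7 : NormedSpace.exp M * (NormedSpace.exp M)ᴴ = 1 := Matrix.mem_unitaryGroup_iff.mp hU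
    rw [h5]
    exact Ring.inverse_unit (⟨_, _, h6, h7⟩ : (Op n)ˣ)
  -- Determinant one only gives `tr M ∈ 2πiℤ`; the bound `‖tr M‖ < 2π` selects zero.
  have htr : Matrix.trace M = 0 := by
    rw [det_exp, Complex.exp_eq_one_iff] at hdet
    obtain ⟨k, hk⟩ := hdet
    rw [hk] at h4 ⊢
    have h8 : ‖(k : ℂ) * (2 * Real.pi * Complex.I)‖ = |(k : ℝ)| * (2 * Real.pi) := by
      simp [abs_of_pos Real.pi_pos]
    rw [h8] at h4
    have h9 : |(k : ℝ)| < 1 := by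
      have := Real.pi_pos
      nlinarith
    have h10 : k = 0 := by
      rw [← Int.cast_abs] at h9
      exact Int.abs_lt_one_iff.mp (by exact_mod_cast h9)
    simp [h10]
  have ht : IsTangent 1 M := by
    apply isTangent_of_skew
    · have h11 : Mᴴ = -M := neg_eq_iff_eq_neg.mp hskew
      simp [h11]
    · simpa using htr
  rw [IsTangent] at ht
  rw [skewL_apply]
  simpa using ht.symm

/-- Logarithmic coordinates around `U`. -/
def expParam (U : SU n) : OpenPartialHomeomorph (Coord n) (SU n) where
  toFun x := ⟨NormedSpace.exp (skewL x), exp_skewL_mem x⟩ * U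
  invFun V := adaptedCoord 1 ((expLocalHomeo n).symm ((V : Op n) * (U : Op n)ᴴ))
  source := skewL ⁻¹' logDomain n
  target := (fun V : SU n => (V : Op n) * (U : Op n)ᴴ) ⁻¹'
    ((expLocalHomeo n).target ∩ (expLocalHomeo n).symm ⁻¹' logDomain n)
  map_source' := by
    intro x hx
    have h : NormedSpace.exp (skewL x) * (U : Op n) * (U : Op n)ᴴ = expLocalHomeo n (skewL x) := by
      rw [Matrix.mul_assoc, coe_mul_conjTranspose, Matrix.mul_one, expLocalHomeo_apply]
    simp only [Set.mem_preimage, Submonoid.coe_mul, h]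
    exact ⟨(expLocalHomeo n).map_source hx.1, by
      rw [Set.mem_preimage, (expLocalHomeo n).left_inv hx.1]; exact hx⟩
  map_target' := by
    rintro V ⟨h1, h2⟩
    rw [Set.mem_preimage, eq_skewL_of_exp_mem h2]
    · exact h2
    · rw [← expLocalHomeo_apply, (expLocalHomeo n).right_inv h1]
      exact (V * U⁻¹).2
  left_inv' := by
    intro x hx
    have h : NormedSpace.exp (skewL x) * (U : Op n) * (U : Op n)ᴴ = expLocalHomeo n (skewL x) := by
      rw [Matrix.mul_assoc, coe_mul_conjTranspose, Matrix.mul_one, expLocalHomeo_apply]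
    simp only [Submonoid.coe_mul, h, (expLocalHomeo n).left_inv hx.1, adaptedCoord_one_skewL]
  right_inv' := by
    rintro V ⟨h1, h2⟩
    apply Subtype.ext
    rw [Submonoid.coe_mul]
    simp only
    rw [eq_skewL_of_exp_mem h2, ← expLocalHomeo_apply, (expLocalHomeo n).right_inv h1,
      Matrix.mul_assoc, conjTranspose_mul_coe, Matrix.mul_one]
    rw [← expLocalHomeo_apply, (expLocalHomeo n).right_inv h1]
    exact (V * U⁻¹).2
  open_source := isOpen_logDomain.preimage skewL.continuous
  open_target :=
    ((expLocalHomeo n).isOpen_inter_preimage_symm isOpen_logDomain).preimage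
      (continuous_subtype_val.mul continuous_const)
  continuousOn_toFun := by
    have h : Continuous fun x : Coord n => NormedSpace.exp (skewL x) :=
      contDiff_exp.continuous.comp skewL.continuous
    exact ((h.subtype_mk exp_skewL_mem).mul continuous_const).continuousOn
  continuousOn_invFun := by
    have h : Continuous fun A : Op n => adaptedCoord (1 : SU n) A :=
      (adaptedCoordL.flip ((1 : SU n) : Op n)).continuous
    refine h.comp_continuousOn ((expLocalHomeo n).continuousOn_symm.comp
      (continuous_subtype_val.mul continuous_const).continuousOn fun V hV => hV.1)

theorem coe_expParam (U : SU n) (x : Coord n) :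
    (expParam U x : Op n) = NormedSpace.exp (skewL x) * (U : Op n) := rfl

theorem isSmoothParam_expParam (U : SU n) : IsSmoothParam (expParam U) := by
  have hsm : ContDiff ℝ ∞ fun x : Coord n => (expParam U x : Op n) :=
    (contDiff_exp.comp skewL.contDiff).mul contDiff_const
  refine ⟨?_, fun x hx => ?_⟩
  · have h : ContDiffOn ℝ ∞ (fun x : Coord n => (expParam U x : Op n)) (expParam U).source :=
      hsm.contDiffOn
    exact h
  · have hd : HasFDerivAt (NormedSpace.exp : Op n → Op n) _ (skewL x) :=
      (contDiff_exp.differentiable (by simp) (skewL x)).hasFDerivAt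
    have h1 := (hd.comp x skewL.hasFDerivAt).mul_const' (U : Op n)
    have h2 : fderiv ℝ (fun x : Coord n => (expParam U x : Op n)) x = _ := h1.fderiv
    rw [h2, injective_iff_map_eq_zero]
    intro v hv
    have hv1 : fderiv ℝ (NormedSpace.exp : Op n → Op n) (skewL x) (skewL v) * (U : Op n) = 0 := hv
    have hv2 : fderiv ℝ (NormedSpace.exp : Op n → Op n) (skewL x) (skewL v) = 0 := by
      have := congrArg (· * (U : Op n)ᴴ) hv1
      simpa [Matrix.mul_assoc, coe_mul_conjTranspose] using this
    -- The derivative of `exp` is at distance less than `1` from the identity, hence injective.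
    have hv3 : skewL v = 0 := by
      by_contra hne
      have h3 := (fderiv ℝ (NormedSpace.exp : Op n → Op n) (skewL x) - 1).le_opNorm (skewL v)
      rw [sub_apply, hv2, zero_sub, norm_neg, one_apply_eq_self] at h3
      have h4 := hx.2.2.1
      have h5 := norm_pos_iff.mpr hne
      nlinarith
    rw [← adaptedCoord_one_skewL v, hv3]
    exact map_zero (adaptedCoordL.flip ((1 : SU n) : Op n))

theorem mem_expParam_target (U : SU n) : U ∈ (expParam U).target := by
  have h : expParam U 0 = U := by
    apply Subtype.ext
    rw [coe_expParam, map_zero, NormedSpace.exp_zero, one_mul]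
  have h0 : (0 : Coord n) ∈ (expParam U).source := by
    change skewL 0 ∈ logDomain n
    rw [map_zero]
    exact zero_mem_logDomain
  simpa only [h] using (expParam U).map_source h0

/-! ### The energy: homogeneity, symmetry and equilibria. -/

namespace FinslerMetric

variable (F : FinslerMetric n)

theorem contDiffOn_energy : ContDiffOn ℝ ∞ F.energy {0}ᶜ := (F.minkowski 1).smooth.pow 2

theorem energy_smul {a : ℝ} (ha : 0 < a) (y : Coord n) : F.energy (a • y) = a ^ 2 * F.energy y := by
  rw [energy, (F.minkowski 1).homogeneous a y ha, mul_pow, energy]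

theorem energy_eq_zero {y : Coord n} (h : F.energy y = 0) : y = 0 :=
  ((F.minkowski 1).eq_zero_iff y).mp (pow_eq_zero_iff (two_ne_zero)|>.mp h)

/-- Compactness of the unit sphere and homogeneity of degree two. This gives differentiability at
the origin, where `F` itself is not assumed smooth. -/
theorem exists_energy_le : ∃ C : ℝ, ∀ y, ‖F.energy y‖ ≤ C * ‖y‖ ^ 2 := by
  have hc : ContinuousOn F.energy (Metric.sphere (0 : Coord n) 1) :=
    F.contDiffOn_energy.continuousOn.mono fun y hy => by
      rintro rfl
      simp at hy
  obtain ⟨C, hC⟩ := (isCompact_sphere (0 : Coord n) 1).exists_bound_of_continuousOn hc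
  refine ⟨C, fun y => ?_⟩
  by_cases hy : y = 0
  · subst hy
    simp [energy, ((F.minkowski 1).eq_zero_iff 0).mpr rfl]
  · have hpos := norm_pos_iff.mpr hy
    have h1 := hC (‖y‖⁻¹ • y) (by simp [norm_smul, hpos.ne'])
    have h2 := F.energy_smul hpos (‖y‖⁻¹ • y)
    rw [smul_inv_smul₀ hpos.ne'] at h2
    rw [h2, norm_mul, norm_pow, norm_norm, mul_comm]
    gcongr

theorem hasFDerivAt_energy_zero : HasFDerivAt F.energy (0 : Coord n →L[ℝ] ℝ) 0 := by
  obtain ⟨C, hC⟩ := F.exists_energy_le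
  refine Asymptotics.IsBigO.hasFDerivAt (n := 2) ?_ (by norm_num)
  refine Asymptotics.IsBigO.of_bound C (Filter.Eventually.of_forall fun y => ?_)
  simpa using hC y

theorem contDiffAt_energy {y : Coord n} (hy : y ≠ 0) : ContDiffAt ℝ ∞ F.energy y :=
  F.contDiffOn_energy.contDiffAt (isOpen_compl_singleton.mem_nhds hy)

theorem differentiable_energy : Differentiable ℝ F.energy := by
  intro y
  by_cases hy : y = 0
  · subst hy
    exact F.hasFDerivAt_energy_zero.differentiableAt
  · exact (F.contDiffAt_energy hy).differentiableAt (by simp)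

/-- Euler's identity for degree two. It shows that zero momentum forces zero velocity. -/
theorem fderiv_energy_self (y : Coord n) : fderiv ℝ F.energy y y = 2 * F.energy y := by
  have h1 : HasDerivAt (fun t : ℝ => t • y) y 1 := by
    have := (hasDerivAt_id (1 : ℝ)).smul_const y
    rwa [one_smul] at this
  have hd : HasFDerivAt F.energy (fderiv ℝ F.energy y) ((1 : ℝ) • y) := by
    rw [one_smul]; exact (F.differentiable_energy y).hasFDerivAt
  have h2 := hd.comp_hasDerivAt (1 : ℝ) h1
  have h3 : HasDerivAt (fun t : ℝ => t ^ 2 * F.energy y) (2 * F.energy y) 1 := by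
    simpa using ((hasDerivAt_pow 2 (1 : ℝ)).mul_const (F.energy y))
  refine h2.unique (h3.congr_of_eventuallyEq ?_)
  filter_upwards [lt_mem_nhds (one_pos : (0 : ℝ) < 1)] with t ht
  exact F.energy_smul ht y

variable {F}

/-- Along the line through `h` in direction `σ` the energy is even, since `h σ = 0`, so its
derivative there equals its own negative. -/
theorem fderiv_energy_single (hsymm : F.IsPauliSymmetric) {h : Coord n} {σ : PauliIndex n}
    (hσ : h σ = 0) : fderiv ℝ F.energy h (Pi.single σ 1) = 0 := by
  have h1 : HasDerivAt (fun t : ℝ => h + t • (Pi.single σ 1 : Coord n)) (Pi.single σ 1) 0 := by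
    have := ((hasDerivAt_id (0 : ℝ)).smul_const (Pi.single σ 1 : Coord n)).const_add h
    rwa [one_smul] at this
  have hd : HasFDerivAt F.energy (fderiv ℝ F.energy h)
      (h + (0 : ℝ) • (Pi.single σ 1 : Coord n)) := by
    rw [zero_smul, add_zero]; exact (F.differentiable_energy h).hasFDerivAt
  have h2 := hd.comp_hasDerivAt (0 : ℝ) h1
  have h3 := HasDerivAt.scomp (h := fun t : ℝ => -t) (g₁ := F.energy ∘
    fun t : ℝ => h + t • (Pi.single σ 1 : Coord n)) (0 : ℝ) (by rwa [neg_zero]) (hasDerivAt_neg 0)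
  have h4 : (F.energy ∘ fun t : ℝ => h + t • (Pi.single σ 1 : Coord n)) ∘ (fun t : ℝ => -t) =
      F.energy ∘ fun t : ℝ => h + t • (Pi.single σ 1 : Coord n) := by
    funext t
    simp only [Function.comp_apply, energy]
    congr 1
    refine hsymm 1 _ _ fun τ => ?_
    by_cases hτ : τ = σ
    · subst hτ; simp [hσ]
    · simp [hτ]
  rw [h4] at h3
  have h5 := h2.unique h3
  rw [neg_one_smul] at h5
  linarith

theorem commute_of_mem_generatedSubgroup {k : ℕ} {g : Fin k → PauliIndex n}
    (hcomm : ∀ i j, Commute (pauli (g i)) (pauli (g j)))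
    {P Q : Matrix.unitaryGroup (Qubits n) ℂ} (hP : P ∈ generatedSubgroup g)
    (hQ : Q ∈ generatedSubgroup g) : Commute (P : Op n) (Q : Op n) := by
  have h : Commute P Q := by
    refine Subgroup.closure_induction₂ (p := fun x y _ _ => Commute x y) ?_ ?_ ?_ ?_ ?_ ?_ ?_ hP hQ
    · rintro _ _ ⟨i, rfl⟩ ⟨j, rfl⟩
      exact Subtype.ext (hcomm i j)
    · intro x _; exact Commute.one_left x
    · intro x _; exact Commute.one_right x
    · intro x y z _ _ _ h1 h2; exact h1.mul_left h2
    · intro y z x _ _ _ h1 h2; exact h1.mul_right h2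
    · intro x y _ _ h1; exact h1.inv_left
    · intro x y _ _ h1; exact h1.inv_right
  exact congrArg Subtype.val h

theorem commute_pauli_of_memUpToSign {k : ℕ} {g : Fin k → PauliIndex n}
    (hcomm : ∀ i j, Commute (pauli (g i)) (pauli (g j))) {σ τ : PauliIndex n}
    (hσ : MemUpToSign (generatedSubgroup g) σ) (hτ : MemUpToSign (generatedSubgroup g) τ) :
    Commute (pauli σ) (pauli τ) := by
  obtain ⟨P, hP, hPσ⟩ := hσ
  obtain ⟨Q, hQ, hQτ⟩ := hτ
  have h := commute_of_mem_generatedSubgroup hcomm hP hQ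
  rcases hPσ with h1 | h1 <;> rcases hQτ with h2 | h2 <;> rw [h1, h2] at h <;>
    simpa [Commute.neg_left_iff, Commute.neg_right_iff] using h

theorem commute_hamiltonian {u v : Coord n}
    (h : ∀ σ τ, u σ ≠ 0 → v τ ≠ 0 → Commute (pauli σ) (pauli τ)) :
    Commute (hamiltonian u) (hamiltonian v) := by
  refine Commute.sum_left _ _ _ fun σ _ => Commute.sum_right _ _ _ fun τ _ => ?_
  by_cases hσ : u σ = 0
  · simp [hσ]
  by_cases hτ : v τ = 0
  · simp [hτ]
  exact ((h σ τ hσ hτ).smul_left _).smul_right _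

/-- The momentum of commuting Paulis is annihilated by the coadjoint action. -/
theorem fderiv_energy_bracket (hsymm : F.IsPauliSymmetric) {h : Coord n}
    (hc : ∀ σ τ, h σ ≠ 0 → h τ ≠ 0 → Commute (pauli σ) (pauli τ)) (w : Coord n) :
    fderiv ℝ F.energy h (bracket h w) = 0 := by
  set p : Coord n := fun σ => fderiv ℝ F.energy h (Pi.single σ 1) with hp
  have hcomm : Commute (hamiltonian h) (hamiltonian p) :=
    commute_hamiltonian fun σ τ hσ hτ =>
      hc σ τ hσ fun h0 => hτ (fderiv_energy_single hsymm h0)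
  have h1 : ∀ v, fderiv ℝ F.energy h v = ∑ σ, p σ * v σ := by
    intro v
    conv_lhs => rw [← Finset.univ_sum_single v]
    rw [map_sum]
    refine Finset.sum_congr rfl fun σ _ => ?_
    have : (Pi.single σ (v σ) : Coord n) = v σ • Pi.single σ 1 := by
      rw [← Pi.single_smul, smul_eq_mul, mul_one]
    rw [this, map_smul, smul_eq_mul, mul_comm]
  have h2 : ∀ A : Op n, ∑ σ, p σ * adaptedCoordL A 1 σ =
      (Complex.I * Matrix.trace (hamiltonian p * A) / 2 ^ n).re := by
    intro A
    simp only [adaptedCoordL_apply, Matrix.conjTranspose_one, Matrix.mul_one, hamiltonian,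
      Finset.sum_mul, Matrix.trace_sum, Finset.mul_sum, Finset.sum_div, Complex.re_sum,
      Matrix.smul_mul, Matrix.trace_smul]
    refine Finset.sum_congr rfl fun σ _ => ?_
    rw [← Complex.re_ofReal_mul, smul_eq_mul]
    congr 1
    ring
  -- Cyclicity: `tr(H_p [H_h, H_w]) = tr([H_p, H_h] H_w) = 0`.
  rw [h1, bracket_apply, h2, mul_sub, Matrix.trace_sub, ← Matrix.mul_assoc,
    ← Matrix.mul_assoc, ← hcomm.eq, Matrix.trace_mul_comm (hamiltonian p * hamiltonian w),
    ← Matrix.mul_assoc, sub_self]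
  simp

/-- Near an equilibrium `h` of the Euler–Arnold equation, its right-hand side is controlled by the
displacement of the momentum, which determines the velocity. -/
theorem eventually_eulerArnold_le {h : Coord n}
    (heq : ∀ w, fderiv ℝ F.energy h (bracket h w) = 0) :
    ∃ K : ℝ, ∀ᶠ γ in nhds h,
      ‖(fderiv ℝ F.energy γ).comp (bracket γ)‖ ≤ K * ‖fderiv ℝ F.energy γ - fderiv ℝ F.energy h‖ ∧
      (fderiv ℝ F.energy γ = fderiv ℝ F.energy h → γ = h) := by
  -- At the origin no second derivative is available, but there the displacement is the momentum
  -- itself, a factor of the right-hand side.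
  by_cases hh : h = 0
  · subst hh
    rw [F.hasFDerivAt_energy_zero.fderiv]
    refine ⟨‖bracket (n := n)‖, ?_⟩
    filter_upwards [Metric.ball_mem_nhds (0 : Coord n) one_pos] with γ hγ
    rw [sub_zero]
    refine ⟨?_, fun h0 => ?_⟩
    · refine (ContinuousLinearMap.opNorm_comp_le _ _).trans ?_
      rw [mul_comm]
      gcongr
      refine (bracket.le_opNorm γ).trans ?_
      rw [mem_ball_zero_iff] at hγ
      exact mul_le_of_le_one_right (norm_nonneg _) hγ.le
    · have h1 := F.fderiv_energy_self γ
      rw [h0] at h1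
      exact F.energy_eq_zero (by simpa using h1.symm)
  · have hd : HasFDerivAt (fderiv ℝ F.energy) (fderiv ℝ (fderiv ℝ F.energy) h) h :=
      (((F.contDiffAt_energy hh).fderiv_right (m := ∞) le_rfl).differentiableAt
        (by simp)).hasFDerivAt
    have hker : (fderiv ℝ (fderiv ℝ F.energy) h).ker = ⊥ := by
      rw [LinearMap.ker_eq_bot']
      intro v hv
      by_contra hne
      have h1 := (F.minkowski 1).hessian_pos h hh v hne
      have h2 : fderiv ℝ (fderiv ℝ F.energy) h v v = 0 := by
        have h3 : fderiv ℝ (fderiv ℝ F.energy) h v = 0 := hv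
        rw [h3]; rfl
      have h4 : (1 / 2 : ℝ) * fderiv ℝ (fderiv ℝ F.energy) h v v > 0 := h1
      rw [h2] at h4
      simp at h4
    obtain ⟨K, -, hK⟩ := LinearMap.exists_antilipschitzWith
      (fderiv ℝ (fderiv ℝ F.energy) h : Coord n →ₗ[ℝ] (Coord n →L[ℝ] ℝ)) hker
    -- The Hessian is positive definite, so `dE` has injective derivative at `h` and displacement of
    -- the velocity is controlled by that of the momentum.
    have hrev : (fun γ => γ - h) =O[nhds h]
        fun γ => fderiv ℝ F.energy γ - fderiv ℝ F.energy h :=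
      (hd.isTheta_sub (hK.isInducing (fderiv ℝ (fderiv ℝ F.energy) h).continuous)).2
    -- The right-hand side is differentiable at `h` and vanishes there, so it is `O(γ - h)`.
    have hΦ := (hd.clm_comp (bracket (n := n)).hasFDerivAt).isBigO_sub
    have h0 : (fderiv ℝ F.energy h).comp (bracket h) = 0 := by
      ext1 w; exact heq w
    simp only [h0, sub_zero] at hΦ
    obtain ⟨C, hC⟩ := (hΦ.trans hrev).bound
    obtain ⟨C', hC'⟩ := hrev.bound
    refine ⟨C, ?_⟩
    filter_upwards [hC, hC'] with γ h1 h2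
    refine ⟨h1, fun h3 => ?_⟩
    rw [h3, sub_self, norm_zero, mul_zero] at h2
    exact sub_eq_zero.mp (norm_le_zero_iff.mp h2)

end FinslerMetric

/-! ### One-parameter subgroups and uniqueness. -/

/-- A short-time uniqueness principle: a function whose derivative is controlled by its
displacement is constant. -/
theorem eq_of_norm_deriv_le_mul_norm_sub {E : Type*} [NormedAddCommGroup E] [NormedSpace ℝ E]
    {p p' : ℝ → E} {a b K : ℝ}
    (hp : ∀ τ ∈ Set.uIcc a b, HasDerivWithinAt p (p' τ) (Set.uIcc a b) τ)
    (hK : 0 ≤ K) (hb : ∀ τ ∈ Set.uIcc a b, ‖p' τ‖ ≤ K * ‖p τ - p a‖) (hab : K * |b - a| < 1) :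
    p b = p a := by
  have hcont : ContinuousOn (fun τ => ‖p τ - p a‖) (Set.uIcc a b) := fun τ hτ =>
    ((hp τ hτ).continuousWithinAt.sub continuousWithinAt_const).norm
  obtain ⟨m, hm, hmax⟩ := isCompact_uIcc.exists_isMaxOn ⟨a, Set.left_mem_uIcc⟩ hcont
  set M := ‖p m - p a‖ with hM
  -- The mean value inequality bounds the largest displacement `M` by `K |b - a| M`, with a factor
  -- below `1`, so `M = 0`.
  have h1 : M ≤ K * M * ‖m - a‖ :=
    (convex_uIcc a b).norm_image_sub_le_of_norm_hasDerivWithin_le hp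
      (fun τ hτ => (hb τ hτ).trans (mul_le_mul_of_nonneg_left (hmax hτ) hK))
      Set.left_mem_uIcc hm
  have h2 : ‖m - a‖ ≤ |b - a| := Set.abs_sub_left_of_mem_uIcc hm
  have h3 : 0 ≤ M := norm_nonneg _
  have h4 : M = 0 := by
    by_contra hne
    have h5 : 0 < M := lt_of_le_of_ne h3 (Ne.symm hne)
    have h6 : K * M * ‖m - a‖ ≤ K * |b - a| * M := by
      rw [mul_right_comm]
      gcongr
    nlinarith
  have h7 : ‖p b - p a‖ ≤ M := hmax Set.right_mem_uIcc
  rw [h4] at h7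
  exact sub_eq_zero.mp (norm_le_zero_iff.mp h7)

/-- The one-parameter subgroup `t ↦ exp(-i t γ · σ)`. -/
def expCurve (γ : Coord n) (t : ℝ) : SU n :=
  ⟨NormedSpace.exp (skewL (t • γ)), exp_skewL_mem (t • γ)⟩

theorem coe_expCurve (γ : Coord n) (t : ℝ) :
    (expCurve γ t : Op n) = NormedSpace.exp (t • skewL γ) := by
  rw [← map_smul]; rfl

theorem expCurve_zero (γ : Coord n) : expCurve γ 0 = 1 := by
  apply Subtype.ext
  rw [coe_expCurve, zero_smul, NormedSpace.exp_zero]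
  rfl

theorem hasDerivAt_expCurve (γ : Coord n) (t : ℝ) :
    HasDerivAt (fun τ => (expCurve γ τ : Op n)) (skewL γ * (expCurve γ t : Op n)) t := by
  simp only [coe_expCurve]
  exact hasDerivAt_exp_smul_const' (𝕂 := ℝ) (skewL γ) t

theorem contDiff_expCurve (γ : Coord n) : ContDiff ℝ ∞ fun t => (expCurve γ t : Op n) := by
  simp only [coe_expCurve]
  exact contDiff_exp.comp (contDiff_id.smul contDiff_const)

theorem velocity_expCurve (γ : Coord n) (t : ℝ) : velocity (expCurve γ) Set.univ t = γ := by
  rw [velocity, derivWithin_univ, (hasDerivAt_expCurve γ t).deriv, adaptedCoord_skewL_mul]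

theorem hasDerivWithinAt_of_velocity {s : ℝ → SU n} {J : Set ℝ} {t : ℝ}
    (hJ : UniqueDiffWithinAt ℝ J t)
    (hs : DifferentiableWithinAt ℝ (fun τ => (s τ : Op n)) J t) :
    HasDerivWithinAt (fun τ => (s τ : Op n)) (skewL (velocity s J t) * (s t : Op n)) J t := by
  have h := isTangent_of_hasDerivWithinAt hJ hs.hasDerivWithinAt
  refine hs.hasDerivWithinAt.congr_deriv ?_
  rw [IsTangent] at h
  rw [h, skewL_apply, neg_mul, smul_mul_assoc]
  rfl

/-- Curves of constant velocity through the identity are one-parameter subgroups. -/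
theorem eq_expCurve_of_velocity {s : ℝ → SU n} {J : Set ℝ} {γ : Coord n} (hJ : UniqueDiffOn ℝ J)
    (hconv : Convex ℝ J) (h0 : 0 ∈ J) (hs : DifferentiableOn ℝ (fun τ => (s τ : Op n)) J)
    (hs0 : s 0 = 1) (hv : ∀ t ∈ J, velocity s J t = γ) {t : ℝ} (ht : t ∈ J) :
    s t = expCurve γ t := by
  -- With `X = skewL γ` the curve solves `s' = X s`, so `exp(-τX) s(τ)` is constant.
  have hd : ∀ τ ∈ J, HasDerivWithinAt
      (fun τ => NormedSpace.exp (τ • -skewL γ) * (s τ : Op n)) 0 J τ := by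
    intro τ hτ
    have h1 := hasDerivWithinAt_of_velocity (hJ τ hτ) (hs τ hτ)
    rw [hv τ hτ] at h1
    have h2 := (hasDerivAt_exp_smul_const (𝕂 := ℝ) (-skewL γ) τ).hasDerivWithinAt (s := J)
    refine (h2.mul h1).congr_deriv ?_
    noncomm_ring
  have hc := hconv.norm_image_sub_le_of_norm_hasDerivWithin_le (C := 0) hd
    (fun τ _ => by rw [norm_zero]) h0 ht
  rw [zero_mul, norm_le_zero_iff, sub_eq_zero, zero_smul, NormedSpace.exp_zero, one_mul, hs0] at hc
  apply Subtype.ext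
  have h3 : NormedSpace.exp (t • skewL γ) * NormedSpace.exp (t • -skewL γ) = 1 := by
    rw [smul_neg, ← NormedSpace.exp_add_of_commute (Commute.refl _).neg_right, add_neg_cancel,
      NormedSpace.exp_zero]
  calc (s t : Op n) = NormedSpace.exp (t • skewL γ) *
        (NormedSpace.exp (t • -skewL γ) * (s t : Op n)) := by rw [← mul_assoc, h3, one_mul]
    _ = _ := by rw [hc, coe_expCurve]; exact mul_one _

namespace FinslerMetric

variable {F : FinslerMetric n}

theorem isGeodesicOn_expCurve (hF : F.IsRightInvariant) {h : Coord n}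
    (heq : ∀ w, fderiv ℝ F.energy h (bracket h w) = 0) :
    F.IsGeodesicOn (expCurve h) Set.univ := by
  refine isGeodesicOn_of_eulerArnold hF F.differentiable_energy uniqueDiffOn_univ
    (contDiff_expCurve h).contDiffOn (fun _ => 0) (fun t _ => ?_) (fun t _ w => ?_)
  · simp only [velocity_expCurve]
    exact hasDerivWithinAt_const _ _ _
  · rw [velocity_expCurve, heq w]
    rfl

/-- A geodesic starting at an equilibrium of the Euler–Arnold equation has constant velocity. -/
theorem IsGeodesicOn.velocity_eq (hF : F.IsRightInvariant) {h : Coord n}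
    (heq : ∀ w, fderiv ℝ F.energy h (bracket h w) = 0) {s : ℝ → SU n} {J : Set ℝ}
    (hs : F.IsGeodesicOn s J) (hJ : UniqueDiffOn ℝ J) (hord : J.OrdConnected) {t₀ : ℝ}
    (ht₀ : t₀ ∈ J) (hv : velocity s J t₀ = h) {t : ℝ} (ht : t ∈ J) : velocity s J t = h := by
  have hsm : ContDiffOn ℝ ∞ (fun τ => (s τ : Op n)) J := hs.smooth
  have hvel : ContinuousOn (velocity s J) J := by
    have h1 := hsm.continuousOn_derivWithin hJ (by simp)
    exact (adaptedCoordL.continuous.comp_continuousOn h1).clm_apply hsm.continuousOn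
  obtain ⟨K, hK⟩ := eventually_eulerArnold_le (F := F) heq
  have hEA : ∀ τ ∈ J, HasDerivWithinAt (fun τ => fderiv ℝ F.energy (velocity s J τ))
      ((fderiv ℝ F.energy (velocity s J τ)).comp (bracket (velocity s J τ))) J τ := fun τ hτ =>
    hs.eulerArnold hF F.differentiable_energy hJ (isSmoothParam_expParam (s τ)) hτ
      (mem_expParam_target (s τ))
  have hopen : ∀ t₁ ∈ J, velocity s J t₁ = h →
      ∀ᶠ τ in nhdsWithin t₁ J, velocity s J τ = h := by
    intro t₁ ht₁ hv₁
    have hcv := hvel t₁ ht₁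
    rw [ContinuousWithinAt, hv₁] at hcv
    have hev := hcv.eventually hK
    rw [eventually_nhdsWithin_iff, Metric.eventually_nhds_iff] at hev ⊢
    obtain ⟨ε, hε, hev⟩ := hev
    -- The second bound ensures `|K| |τ - t₁| < 1`, as short-time uniqueness requires; `K` has no
    -- known sign, hence `|K|`.
    refine ⟨min ε (1 / (|K| + 1)), lt_min hε (by positivity), fun τ hτ hτJ => ?_⟩
    have hsub : Set.uIcc t₁ τ ⊆ J := hord.uIcc_subset ht₁ hτJ
    have hnear : ∀ r ∈ Set.uIcc t₁ τ, dist r t₁ < ε := fun r hr =>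
      (Set.abs_sub_left_of_mem_uIcc hr).trans_lt (hτ.trans_le (min_le_left _ _))
    refine (hev (hnear τ Set.right_mem_uIcc) hτJ).2 ?_
    have hconst := eq_of_norm_deriv_le_mul_norm_sub (K := |K|)
      (fun r hr => (hEA r (hsub hr)).mono hsub) (abs_nonneg K)
      (fun r hr => by
        rw [hv₁]
        exact (hev (hnear r hr) (hsub hr)).1.trans
          (mul_le_mul_of_nonneg_right (le_abs_self K) (norm_nonneg _)))
      (by
        have h1 : |τ - t₁| < 1 / (|K| + 1) := hτ.trans_le (min_le_right _ _)
        rw [lt_div_iff₀ (by positivity)] at h1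
        nlinarith [abs_nonneg (τ - t₁)])
    rw [hconst, hv₁]
  have : PreconnectedSpace J := Subtype.preconnectedSpace hord.isPreconnected
  -- Closed by continuity of the velocity, open by `hopen`; `J` is connected.
  have hclopen : IsClopen {r : J | velocity s J r = h} := by
    constructor
    · exact isClosed_eq hvel.domRestrict continuous_const
    · rw [isOpen_iff_eventually]
      rintro ⟨r, hr⟩ hrv
      have := hopen r hr hrv
      rw [nhdsWithin_eq_map_subtype_coe hr] at this
      exact this
  have huniv := hclopen.eq_univ ⟨⟨t₀, ht₀⟩, hv⟩
  exact (Set.eq_univ_iff_forall.mp huniv) ⟨t, ht⟩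

end FinslerMetric

theorem uniqueDiffOn_of_ordConnected {J : Set ℝ} (hJ : J.OrdConnected) (hn : J.Nontrivial) :
    UniqueDiffOn ℝ J :=
  uniqueDiffOn_convex hJ.convex
    (hJ.convex.nontrivial_iff_nonempty_interior.mp hn)

theorem exists_geodesic_of_commuting_paulis {k : ℕ} (F : FinslerMetric n)
    (hright : F.IsRightInvariant) (hsymm : F.IsPauliSymmetric) (g : Fin k → PauliIndex n)
    (hcomm : ∀ i j, Commute (pauli (g i)) (pauli (g j))) (h : Coord n)
    (hS : ∀ σ, h σ ≠ 0 → MemUpToSign (generatedSubgroup g) σ) :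
    ∃ U : ℝ → SU n,
      (∀ t, (U t : Op n) = NormedSpace.exp (-(Complex.I * (t : ℂ)) • hamiltonian h)) ∧
      F.IsGeodesicOn U Set.univ ∧
      U 0 = 1 ∧
      HasDerivAt (fun t => (U t : Op n)) (-Complex.I • hamiltonian h) 0 ∧
      ∀ (J : Set ℝ) (s : ℝ → SU n), J.OrdConnected → 0 ∈ J →
        F.IsGeodesicOn s J → s 0 = 1 →
        HasDerivWithinAt (fun t => (s t : Op n)) (-Complex.I • hamiltonian h) J 0 →
        ∀ t ∈ J, s t = U t := by
  have heq : ∀ w, fderiv ℝ F.energy h (bracket h w) = 0 :=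
    FinslerMetric.fderiv_energy_bracket hsymm fun σ τ hσ hτ =>
      FinslerMetric.commute_pauli_of_memUpToSign hcomm (hS σ hσ) (hS τ hτ)
  have hskew : -Complex.I • hamiltonian h = skewL h := by rw [skewL_apply, neg_smul]
  refine ⟨expCurve h, fun t => ?_, FinslerMetric.isGeodesicOn_expCurve hright heq,
    expCurve_zero h, ?_, ?_⟩
  · rw [coe_expCurve, skewL_apply, ← Complex.coe_smul, smul_neg, smul_smul, neg_smul,
      mul_comm Complex.I]
  · have h1 := hasDerivAt_expCurve h 0
    rw [expCurve_zero] at h1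
    refine h1.congr_deriv ?_
    rw [hskew]
    exact mul_one _
  · intro J s hord h0 hs hs0 hderiv t ht
    -- On a one-point interval derivatives are not unique and velocity carries no information, but
    -- `s 0 = 1` suffices.
    rcases J.subsingleton_or_nontrivial with hJ | hJ
    · rw [hJ ht h0, hs0, expCurve_zero]
    · have hu := uniqueDiffOn_of_ordConnected hord hJ
      have hsm : ContDiffOn ℝ ∞ (fun τ => (s τ : Op n)) J := hs.smooth
      have hv0 : velocity s J 0 = h := by
        rw [velocity, hderiv.derivWithin (hu 0 h0), hskew, hs0, adaptedCoord_one_skewL]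
      exact eq_expCurve_of_velocity hu hord.convex h0 (hsm.differentiableOn (by simp)) hs0
        (fun τ hτ => hs.velocity_eq hright heq hu hord h0 hv0 hτ) ht

end PauliFinsler

end

theorem mainTheorem6 {n k : ℕ} (F : PauliFinsler.FinslerMetric n)
    (hright : F.IsRightInvariant) (hsymm : F.IsPauliSymmetric)
    (g : Fin k → PauliFinsler.PauliIndex n)
    (hcomm : ∀ i j, Commute (PauliFinsler.pauli (g i)) (PauliFinsler.pauli (g j)))
    (h : PauliFinsler.Coord n)
    (hS : ∀ σ, h σ ≠ 0 → PauliFinsler.MemUpToSign (PauliFinsler.generatedSubgroup g) σ) :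
    ∃ U : ℝ → PauliFinsler.SU n,
      (∀ t, (U t : PauliFinsler.Op n) =
        NormedSpace.exp (-(Complex.I * (t : ℂ)) • PauliFinsler.hamiltonian h)) ∧
      F.IsGeodesicOn U Set.univ ∧
      U 0 = 1 ∧
      HasDerivAt (fun t => (U t : PauliFinsler.Op n))
        (-Complex.I • PauliFinsler.hamiltonian h) 0 ∧
      ∀ (J : Set ℝ) (s : ℝ → PauliFinsler.SU n), J.OrdConnected → 0 ∈ J →
        F.IsGeodesicOn s J → s 0 = 1 →
        HasDerivWithinAt (fun t => (s t : PauliFinsler.Op n))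
          (-Complex.I • PauliFinsler.hamiltonian h) J 0 →
        ∀ t ∈ J, s t = U t := by
  exact PauliFinsler.exists_geodesic_of_commuting_paulis F hright hsymm g hcomm h hS
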